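/- Let $T>0$, let $(\Omega,\mathcal G,P)$ be a probability space and let $W=(W_t)_{t\ge 0}$ be a standard $d$-dimensional Brownian motion on it (started at $0$). For $s\in\mathbb R$ and $1\le r<\infty$ let $H^s_r(\mathbb R^d)$ be the space of real tempered distributions $u$ on $\mathbb R^d$ with $(I-\frac12\Delta)^{s/2}u\in L^r(\mathbb R^d)$ (the power being defined by Fourier transform), with norm $\|u\|_{H^s_r}=\|(I-\frac12\Delta)^{s/2}u\|_{L^r}$; $H^s_r$ denotes the space of $\mathbb R^d$-valued distributions with all $d$ components in $H^s_r(\mathbb R^d)$, and $C([0,T];H^s_r)$ carries the sup norm. Let $\mathcal C$ be the space of continuous $\mathbb R^d$-valued processes indexed by $[0,T]$ (identified when almost surely equal), with uniform convergence in probability (u.c.p.), i.e. $X^n\to X$ if $\sup_{t\le T}|X^n_t-X_t|\to0$ in probability. The covariation of two real processes is $[X,Y]_t=\lim_{\varepsilon\to0+}\frac1\varepsilon\int_0^t(X_{q+\varepsilon}-X_q)(Y_{q+\varepsilon}-Y_q)\,dq$ (limit u.c.p.), and $[W,W]$ is the matrix with entries $[W^i,W^j]$. For $l\in C_c([0,T]\times\mathbb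 R^d;\mathbb R^d)$ set $$A^{W,W}_t(l)=\Big(\int_0^t l^*(q,W_q)\,d[W,W]_q\Big)^*,\qquad t\in[0,T].$$ Let $-\frac12<s\le 0$ and $2\le r<\infty$, and suppose that $A^{W,W}$ is well defined on $C([0,T];H^s_r)$, that is, that the operator $A^{W,W}:C_c([0,T]\times\mathbb R^d;\mathbb R^d)\to\mathcal C$ has a continuous extension $A^{W,W}:C([0,T];H^s_r)\to\mathcal C$. Let $g\in C([0,T];H^s_r)\cap L^\infty_{\mathrm{loc}}([0,T]\times\mathbb R^d;\mathbb R^d)$, i.e. $g\in C([0,T];H^s_r)$ and there is a measurable function, still denoted by $g$, that is essentially bounded on $[0,T]\times K$ for every compact $K\subset\mathbb R^d$ and that represents the distribution $g(t)$ for almost every $t\in[0,T]$. Then, almost surely, $q\mapsto g(q,W_q)$ is integrable on $[0,T]$ and $$A^{W,W}_t(g)=\int_0^t g(q,W_q)\,dq\qquad\text{for all } t\in[0,T].$$ -/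

import Mathlib

open MeasureTheory ProbabilityTheory Filter Set
open scoped NNReal ENNReal Topology SchwartzMap

/-- The Euclidean space `ℝ^d`. -/
abbrev Rd (d : ℕ) : Type := EuclideanSpace ℝ (Fin d)

/-! ### Fractional Sobolev spaces -/

/-- The symbol of `(I - Δ/2)^(s/2)`. In Mathlib's normalization of the Fourier transform
`-Δ` has the symbol `(2π|ξ|)²`, so that `I - Δ/2` has the symbol `1 + 2π²|ξ|²`. -/
noncomputable def sobolevSymbol (d : ℕ) (s : ℝ) (ξ : Rd d) : ℝ :=
  (1 + 2 * Real.pi ^ 2 * ‖ξ‖ ^ 2) ^ (s / 2)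

theorem sobolevSymbol_hasTemperateGrowth (d : ℕ) (s : ℝ) :
    (sobolevSymbol d s).HasTemperateGrowth := by
  have h := (Function.hasTemperateGrowth_one_add_norm_sq_rpow (Rd d) (s / 2)).comp
    (((Real.sqrt 2 * Real.pi) • ContinuousLinearMap.id ℝ (Rd d)).hasTemperateGrowth)
  have h2 : Real.sqrt 2 ^ 2 = 2 := Real.sq_sqrt (by norm_num)
  have he : sobolevSymbol d s = (fun x : Rd d => (1 + ‖x‖ ^ 2) ^ (s / 2)) ∘
      ((Real.sqrt 2 * Real.pi) • ContinuousLinearMap.id ℝ (Rd d)) := by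
    funext ξ
    simp only [sobolevSymbol, Function.comp_apply, _root_.smul_apply,
      ContinuousLinearMap.id_apply, norm_smul, mul_pow, Real.norm_eq_abs, sq_abs, h2]
  rw [he]
  exact h

/-- The fractional power `(I - Δ/2)^(s/2)` on tempered distributions, by Fourier transform. -/
noncomputable def fracPower (d : ℕ) (s : ℝ) : 𝓢'(Rd d, ℂ) →L[ℂ] 𝓢'(Rd d, ℂ) :=
  TemperedDistribution.fourierMultiplierCLM ℂ (fun ξ => (sobolevSymbol d s ξ : ℂ))

theorem fracPower_neg_fracPower (d : ℕ) (s : ℝ) (u : 𝓢'(Rd d, ℂ)) :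
    fracPower d (-s) (fracPower d s u) = u := by
  have hg : ∀ a : ℝ, (fun ξ : Rd d => (sobolevSymbol d a ξ : ℂ)).HasTemperateGrowth := fun a =>
    Complex.ofRealCLM.hasTemperateGrowth.comp (sobolevSymbol_hasTemperateGrowth d a)
  unfold fracPower
  rw [TemperedDistribution.fourierMultiplierCLM_fourierMultiplierCLM_apply (hg s) (hg (-s))]
  have h1 : ((fun ξ : Rd d => (sobolevSymbol d s ξ : ℂ)) * fun ξ => (sobolevSymbol d (-s) ξ : ℂ)) =
      fun _ => (1 : ℂ) := by
    funext ξ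
    have hpos : (0 : ℝ) < 1 + 2 * Real.pi ^ 2 * ‖ξ‖ ^ 2 := by positivity
    simp only [Pi.mul_apply, sobolevSymbol]
    norm_cast
    rw [← Real.rpow_add hpos]
    ring_nf
    simp
  rw [h1]
  simp

/-- A tempered distribution is real if it takes real values on real test functions. -/
def IsRealDistribution {d : ℕ} (u : 𝓢'(Rd d, ℂ)) : Prop :=
  ∀ φ : 𝓢(Rd d, ℂ), (∀ x, (φ x).im = 0) → (u φ).im = 0

/-- The real fractional Sobolev space `H^s_r(ℝ^d)`: the real tempered distributions `u` with
`(I - Δ/2)^(s/2) u ∈ L^r(ℝ^d)`. -/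
noncomputable def sobolevSubmodule (d : ℕ) (s : ℝ) (r : ℝ≥0∞) [Fact (1 ≤ r)] :
    Submodule ℝ 𝓢'(Rd d, ℂ) where
  carrier := {u | IsRealDistribution u ∧
    ∃ f : Lp ℂ r (volume : Measure (Rd d)), fracPower d s u = (f : 𝓢'(Rd d, ℂ))}
  zero_mem' := by
    refine ⟨fun φ _ => by simp, 0, ?_⟩
    rw [map_zero, ← Lp.toTemperedDistributionCLM_apply, map_zero]
  add_mem' := by
    rintro u v ⟨hu, f, hf⟩ ⟨hv, g, hg⟩
    refine ⟨fun φ hφ => ?_, f + g, ?_⟩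
    · simp [hu φ hφ, hv φ hφ]
    · rw [map_add, ← Lp.toTemperedDistributionCLM_apply, map_add, hf, hg]
      rfl
  smul_mem' := by
    rintro c u ⟨hu, f, hf⟩
    refine ⟨fun φ hφ => ?_, (c : ℂ) • f, ?_⟩
    · simp [hu φ hφ]
    · have hc : c • u = (c : ℂ) • u := by ext φ; simp
      rw [hc, map_smul, ← Lp.toTemperedDistributionCLM_apply, map_smul, hf]
      rfl

/-- The space `H^s_r(ℝ^d)` as a type of its own, so that it does not inherit the topology of the
tempered distributions. -/
def Sobolev (d : ℕ) (s : ℝ) (r : ℝ≥0∞) [Fact (1 ≤ r)] : Type := sobolevSubmodule d s r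

namespace Sobolev

variable {d : ℕ} {s : ℝ} {r : ℝ≥0∞} [Fact (1 ≤ r)]

noncomputable instance instAddCommGroup : AddCommGroup (Sobolev d s r) :=
  inferInstanceAs (AddCommGroup (sobolevSubmodule d s r))

noncomputable instance instModule : Module ℝ (Sobolev d s r) :=
  inferInstanceAs (Module ℝ (sobolevSubmodule d s r))

/-- The distribution underlying an element of `H^s_r`. -/
noncomputable def toDistribution (d : ℕ) (s : ℝ) (r : ℝ≥0∞) [Fact (1 ≤ r)] :
    Sobolev d s r →ₗ[ℝ] 𝓢'(Rd d, ℂ) :=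
  (sobolevSubmodule d s r).subtype

/-- The function `(I - Δ/2)^(s/2) u ∈ L^r` of `u ∈ H^s_r`. -/
noncomputable def toLp (u : Sobolev d s r) : Lp ℂ r (volume : Measure (Rd d)) :=
  u.2.2.choose

theorem toLp_spec (u : Sobolev d s r) :
    fracPower d s (toDistribution d s r u) = (u.toLp : 𝓢'(Rd d, ℂ)) :=
  u.2.2.choose_spec

theorem toTemperedDistribution_injective :
    Function.Injective (Lp.toTemperedDistributionCLM ℂ (volume : Measure (Rd d)) r) :=
  LinearMap.ker_eq_bot.mp Lp.ker_toTemperedDistributionCLM_eq_bot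

theorem toLp_add (u v : Sobolev d s r) : (u + v).toLp = u.toLp + v.toLp := by
  apply toTemperedDistribution_injective
  rw [map_add]
  simp only [Lp.toTemperedDistributionCLM_apply, ← toLp_spec]
  rw [map_add, map_add]

theorem toLp_smul (c : ℝ) (u : Sobolev d s r) : (c • u).toLp = c • u.toLp := by
  have hc : c • u.toLp = (c : ℂ) • u.toLp := by
    ext1
    filter_upwards [Lp.coeFn_smul c u.toLp, Lp.coeFn_smul (c : ℂ) u.toLp] with x h1 h2
    rw [h1, h2]
    simp
  have hu : toDistribution d s r (c • u) = (c : ℂ) • toDistribution d s r u := by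
    rw [map_smul]
    ext φ
    simp
  rw [hc]
  apply toTemperedDistribution_injective
  rw [map_smul]
  simp only [Lp.toTemperedDistributionCLM_apply, ← toLp_spec]
  rw [hu, map_smul]

/-- The map `(I - Δ/2)^(s/2) : H^s_r → L^r`. -/
noncomputable def toLpHom (d : ℕ) (s : ℝ) (r : ℝ≥0∞) [Fact (1 ≤ r)] :
    Sobolev d s r →ₗ[ℝ] Lp ℂ r (volume : Measure (Rd d)) where
  toFun := toLp
  map_add' := toLp_add
  map_smul' := toLp_smul

theorem toLpHom_injective : Function.Injective (toLpHom d s r) := by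
  intro u v h
  have h' : u.toLp = v.toLp := h
  have h2 : toDistribution d s r u = toDistribution d s r v := by
    rw [← fracPower_neg_fracPower d s (toDistribution d s r u),
      ← fracPower_neg_fracPower d s (toDistribution d s r v), toLp_spec, toLp_spec, h']
  exact Subtype.ext h2

/-- `H^s_r` carries the norm `‖u‖ = ‖(I - Δ/2)^(s/2) u‖_{L^r}`. -/
noncomputable instance instNormedAddCommGroup : NormedAddCommGroup (Sobolev d s r) :=
  NormedAddCommGroup.induced (Sobolev d s r) (Lp ℂ r (volume : Measure (Rd d)))
    (toLpHom d s r) toLpHom_injective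

end Sobolev

/-- The space `H^s_r(ℝ^d; ℝ^d)`, defined componentwise. -/
abbrev SobolevVec (d : ℕ) (s : ℝ) (r : ℝ≥0∞) [Fact (1 ≤ r)] : Type := Fin d → Sobolev d s r

/-! ### Time dependent functions -/

/-- `l ∈ C_c([0,T] × ℝ^d; ℝ^d)`; only the values of `l` at times in `[0,T]` matter. -/
def IsContinuousCompactSupport {d : ℕ} (T : ℝ) (l : ℝ → Rd d → Rd d) : Prop :=
  ContinuousOn (Function.uncurry l) (Icc 0 T ×ˢ univ) ∧
    ∃ K : Set (Rd d), IsCompact K ∧ ∀ t ∈ Icc 0 T, ∀ x ∉ K, l t x = 0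

/-- `g ∈ L^∞_loc([0,T] × ℝ^d; ℝ^d)`: measurable and essentially bounded on `[0,T] × K` for every
compact `K`. -/
def IsLocallyBounded {d : ℕ} (T : ℝ) (g : ℝ → Rd d → Rd d) : Prop :=
  ∀ K : Set (Rd d), IsCompact K →
    MemLp (Function.uncurry g) ∞ ((volume : Measure (ℝ × Rd d)).restrict (Icc 0 T ×ˢ K))

/-- The element `u` of `C([0,T]; H^s_r)` is the function `g` (given up to null sets of
`[0,T] × ℝ^d`): for almost every `t`, the distribution `u(t)` is integration against `g(t, ·)`,
component by component, on compactly supported test functions. -/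
def IsGivenBy {d : ℕ} {s : ℝ} {r : ℝ≥0∞} [Fact (1 ≤ r)] {T : ℝ}
    (u : C(Icc (0 : ℝ) T, SobolevVec d s r)) (g : ℝ → Rd d → Rd d) : Prop :=
  ∀ᵐ t ∂(volume : Measure ℝ), ∀ ht : t ∈ Icc (0 : ℝ) T, ∀ i : Fin d, ∀ φ : 𝓢(Rd d, ℂ),
    HasCompactSupport φ →
      Sobolev.toDistribution d s r (u ⟨t, ht⟩ i) φ = ∫ x, φ x * ((g t x i : ℝ) : ℂ)

/-! ### Processes -/

/-- `W` is a standard `d`-dimensional Brownian motion (started at `0`, almost surely continuous):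
its components are independent real Brownian motions. -/
structure IsBrownianVec {Ω : Type*} [MeasurableSpace Ω] {d : ℕ} (W : ℝ≥0 → Ω → Rd d)
    (P : Measure Ω) : Prop where
  measurable : ∀ t, Measurable (W t)
  isBrownianReal : ∀ i, IsBrownianReal (fun t ω => W t ω i) P
  independent : iIndepFun (fun (i : Fin d) (ω : Ω) (t : ℝ≥0) => W t ω i) P

/-- Continuous stochastic processes indexed by `[0,T]`; only the values at times in `[0,T]`
matter. -/
structure ContinuousProcess (Ω : Type*) [MeasurableSpace Ω] (T : ℝ) (F : Type*)
    [TopologicalSpace F] [MeasurableSpace F] where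
  val : ℝ → Ω → F
  measurable : ∀ t ∈ Icc 0 T, Measurable (val t)
  continuousOn : ∀ ω, ContinuousOn (fun t => val t ω) (Icc 0 T)

/-- Uniform convergence in probability on `[0,T]` (u.c.p.):
`sup_{t ∈ [0,T]} |X^n_t - X_t| → 0` in probability. -/
def TendstoUCP {Ω ι F : Type*} [MeasurableSpace Ω] [PseudoMetricSpace F] (P : Measure Ω) (T : ℝ)
    (X : ι → ℝ → Ω → F) (a : Filter ι) (Y : ℝ → Ω → F) : Prop :=
  ∀ η : ℝ, 0 < η →
    Tendsto (fun n => P {ω | ∃ t ∈ Icc 0 T, η ≤ dist (X n t ω) (Y t ω)}) a (𝓝 0)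

/-- `C` is the covariation `[X, Y]` on `[0,T]`, in the sense of regularization:
`[X,Y]_t = lim_{ε → 0+} (1/ε) ∫_0^t (X_{s+ε} - X_s) (Y_{s+ε} - Y_s) ds` u.c.p. -/
def IsCovariation {Ω : Type*} [MeasurableSpace Ω] (P : Measure Ω) (T : ℝ) (X Y : ℝ≥0 → Ω → ℝ)
    (C : ℝ → Ω → ℝ) : Prop :=
  TendstoUCP P T
    (fun (ε : ℝ) t ω => ε⁻¹ * ∫ s in (0 : ℝ)..t,
      (X (s + ε).toNNReal ω - X s.toNNReal ω) * (Y (s + ε).toNNReal ω - Y s.toNNReal ω))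
    (𝓝[>] 0) C

/-- `I = ∫_0^t f dc`, as a limit of Riemann-Stieltjes sums. For `f` continuous and `c` continuous
of bounded variation, the only case in use, the limit exists and it is the Lebesgue-Stieltjes
integral. -/
def IsStieltjesIntegral (f c : ℝ → ℝ) (t I : ℝ) : Prop :=
  Tendsto (fun n : ℕ => ∑ k ∈ Finset.range n,
    f (t * k / n) * (c (t * (k + 1) / n) - c (t * k / n))) atTop (𝓝 I)

/-- `C` is the covariation matrix `[W, Y]` on `[0,T]`, and its entries have finite variation. -/
def IsFVCovariationMatrix {Ω : Type*} [MeasurableSpace Ω] {d : ℕ} (P : Measure Ω) (T : ℝ)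
    (W Y : ℝ≥0 → Ω → Rd d) (C : Fin d → Fin d → ContinuousProcess Ω T ℝ) : Prop :=
  ∀ i j, IsCovariation P T (fun t ω => W t ω i) (fun t ω => Y t ω j) (C i j).val ∧
    ∀ᵐ ω ∂P, BoundedVariationOn (fun t => (C i j).val t ω) (Icc 0 T)

/-- `X` is the process `(∫_0^· l(r, W_r)^* d[W, Y]_r)^*`, where `C = [W, Y]`. -/
def IsIntegralAgainst {Ω : Type*} [MeasurableSpace Ω] {d : ℕ} (P : Measure Ω) {T : ℝ}
    (W : ℝ≥0 → Ω → Rd d) (C : Fin d → Fin d → ContinuousProcess Ω T ℝ) (l : ℝ → Rd d → Rd d)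
    (X : ContinuousProcess Ω T (Rd d)) : Prop :=
  ∀ᵐ ω ∂P, ∀ t ∈ Icc 0 T, ∃ I : Fin d → Fin d → ℝ,
    (∀ i j, IsStieltjesIntegral (fun q => l q (W q.toNNReal ω) i) (fun q => (C i j).val q ω)
      t (I i j)) ∧
    ∀ j, X.val t ω j = ∑ i, I i j

/-- The integral operator `A^{W,Y}` is well defined on `E = C([0,T]; H^s_r)` and is equal to `A`:
the covariation `[W, Y]` exists and has finite variation, and `A`, with values in the continuous
processes with u.c.p. convergence, is a continuous extension of
`l ↦ (∫_0^· l(r, W_r)^* d[W, Y]_r)^*`, `l ∈ C_c([0,T] × ℝ^d; ℝ^d)`. Processes are identified if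
they are almost surely equal. -/
structure IsIntegralOperator {Ω : Type*} [MeasurableSpace Ω] {d : ℕ} {s : ℝ} {r : ℝ≥0∞}
    [Fact (1 ≤ r)] {T : ℝ} (P : Measure Ω) (W Y : ℝ≥0 → Ω → Rd d)
    (A : C(Icc (0 : ℝ) T, SobolevVec d s r) → ContinuousProcess Ω T (Rd d)) : Prop where
  extension : ∃ C : Fin d → Fin d → ContinuousProcess Ω T ℝ, IsFVCovariationMatrix P T W Y C ∧
    ∀ l, IsContinuousCompactSupport T l →
      ∀ u : C(Icc (0 : ℝ) T, SobolevVec d s r), IsGivenBy u l → IsIntegralAgainst P W C l (A u)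
  continuity : ∀ u, TendstoUCP P T (fun v => (A v).val) (𝓝 u) (A u).val

/-! ### Averages of translates in `L^r` -/

section ShiftAverage

variable {d : ℕ} {r : ℝ≥0∞}

/-! Since `[W,W]_t = t I`, the identity holds for continuous compactly supported integrands, and it
is carried to `u` by one approximating sequence that converges in two senses at once: in `C([0,T];
H^s_r)`, where `A` is continuous, and almost everywhere with local bounds, where time integrals
along Brownian paths pass to the limit. The sequence is `l_n = χ_{R_n} (ρ_n * u)`, a mollification
followed by a spatial cutoff.

Convergence in `H^s_r`: put `f = (I - Δ/2)^(s/2) u ∈ L^r`. Mollification is a Fourier multiplier, so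
`ρ * u` is the average of translates of `f` with the Schwartz density `(I - Δ/2)^(-s/2) ρ`. It is
therefore an `L^r` function, and cutting off at a large radius changes it little in `L^r`. For `s ≤
0` the operator `(I - Δ/2)^(s/2)` is bounded on `L^r`, being an average of translates against a
mixture of Gaussian laws, so the cutoff error is also small in `H^s_r`. The mollification error in
`H^s_r` is that of `f` in `L^r`. Compactness of `[0,T]` makes both uniform in time
(`exists_dist_regularizeMap_le`).

Convergence along paths: as `u` is the function `g`, `l_n` is a cutoff of `ρ_n * g(t, ·)`. It
converges to `g` almost everywhere by Lebesgue differentiation and is bounded on each ball uniformly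
in `n`. The law of `W_q` is absolutely continuous for `q > 0`, so by Fubini almost every path sees
the convergence at almost every time. A path stays in a ball up to time `T`, and dominated
convergence applies (`IsBrownianVec.ae_tendsto_integral_regularizeFun`).

Finally, `A(l_n) → A(u)` u.c.p., hence almost surely along a subsequence at each fixed time, and
path continuity upgrades the equality to all times at once. -/

theorem shift_ae_eq (y : Rd d) (f : Lp ℂ r (volume : Measure (Rd d))) :
    (DomAddAct.mk y +ᵥ f : Lp ℂ r (volume : Measure (Rd d))) =ᵐ[volume] fun x => f (y + x) :=
  DomAddAct.vadd_Lp_ae_eq (DomAddAct.mk y) f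

theorem lintegral_mul_shift_ne_top (φ : 𝓢(Rd d, ℂ)) (f : Lp ℂ r (volume : Measure (Rd d))) :
    eLpNorm φ (1 - r⁻¹)⁻¹ volume * eLpNorm f r volume ≠ ∞ :=
  ENNReal.mul_ne_top (φ.memLp _ _).2.ne (Lp.eLpNorm_ne_top f)

variable [Fact (1 ≤ r)]

/-- Hölder with the conjugate exponent and translation invariance. The bound is free of `y`, so it
can be integrated against any integrable weight in `y`. -/
theorem lintegral_mul_shift_le (y : Rd d) (φ : 𝓢(Rd d, ℂ))
    (f : Lp ℂ r (volume : Measure (Rd d))) :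
    ∫⁻ x, ‖φ x * f (y + x)‖ₑ ≤
      eLpNorm φ (1 - r⁻¹)⁻¹ volume * eLpNorm f r volume := by
  have hp := (Fact.out : 1 ≤ r)
  have : ENNReal.HolderConjugate r (1 - r⁻¹)⁻¹ := ENNReal.HolderConjugate.inv_one_sub_inv' hp
  have : ENNReal.HolderTriple (1 - r⁻¹)⁻¹ r 1 := ENNReal.HolderTriple.symm
  have hmp := measurePreserving_add_left (volume : Measure (Rd d)) y
  have hf : AEStronglyMeasurable (fun x => f (y + x)) volume :=
    ((Lp.stronglyMeasurable f).comp_measurable (measurable_const_add y)).aestronglyMeasurable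
  have h := eLpNorm_smul_le_mul_eLpNorm (p := (1 - r⁻¹)⁻¹) (q := r) (r := 1) hf
    (φ.continuous.aestronglyMeasurable (μ := volume))
  rw [eLpNorm_one_eq_lintegral_enorm] at h
  refine h.trans (le_of_eq ?_)
  congr 1
  exact eLpNorm_comp_measurePreserving (Lp.aestronglyMeasurable f) hmp

/-- The integrability behind every exchange of a translation average with a pairing. -/
theorem integrable_mul_mul_shift {ν : Measure (Rd d)} [SFinite ν] {h : Rd d → ℂ}
    (hh : Integrable h ν) (φ : 𝓢(Rd d, ℂ)) (f : Lp ℂ r (volume : Measure (Rd d))) :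
    Integrable (fun p : Rd d × Rd d => h p.1 * (φ p.2 * f (p.1 + p.2))) (ν.prod volume) := by
  have hm : AEStronglyMeasurable (fun p : Rd d × Rd d => h p.1 * (φ p.2 * f (p.1 + p.2)))
      (ν.prod volume) := by
    refine hh.1.comp_fst.mul (AEStronglyMeasurable.mul ?_ ?_)
    · exact (φ.continuous.comp continuous_snd).aestronglyMeasurable
    · exact ((Lp.stronglyMeasurable f).comp_measurable
        (measurable_fst.add measurable_snd)).aestronglyMeasurable
  refine ⟨hm, ?_⟩
  rw [HasFiniteIntegral, lintegral_prod _ hm.enorm]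
  calc ∫⁻ y, ∫⁻ x, ‖h y * (φ x * f (y + x))‖ₑ ∂volume ∂ν
      ≤ ∫⁻ y, ‖h y‖ₑ * (eLpNorm φ (1 - r⁻¹)⁻¹ volume * eLpNorm f r volume) ∂ν := by
        refine lintegral_mono fun y => ?_
        simp only [enorm_mul (h y)]
        rw [lintegral_const_mul' _ _ enorm_ne_top]
        gcongr
        exact lintegral_mul_shift_le y φ f
    _ < ∞ := by
        rw [lintegral_mul_const' _ _ (lintegral_mul_shift_ne_top φ f)]
        exact ENNReal.mul_lt_top hh.2 (lintegral_mul_shift_ne_top φ f).lt_top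

/-- Evaluation of the distribution of an `L^r` function at a test function. -/
noncomputable def lpPair (φ : 𝓢(Rd d, ℂ)) : Lp ℂ r (volume : Measure (Rd d)) →L[ℂ] ℂ :=
  haveI := ENNReal.HolderConjugate.inv_one_sub_inv' (Fact.out : 1 ≤ r)
  haveI : Fact (1 ≤ (1 - r⁻¹)⁻¹) := by simp [fact_iff]
  ((ContinuousLinearMap.lsmul ℂ ℂ (E := ℂ)).flip.lpPairing volume r (1 - r⁻¹)⁻¹).flip
    (φ.toLp (1 - r⁻¹)⁻¹ volume)

theorem lpPair_apply (φ : 𝓢(Rd d, ℂ)) (f : Lp ℂ r (volume : Measure (Rd d))) :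
    lpPair φ f = (f : 𝓢'(Rd d, ℂ)) φ := rfl

theorem lpPair_eq_integral (φ : 𝓢(Rd d, ℂ)) (f : Lp ℂ r (volume : Measure (Rd d))) :
    lpPair φ f = ∫ x, φ x * f x := by
  rw [lpPair_apply, Lp.toTemperedDistribution_apply]
  rfl

theorem lpPair_shift (φ : 𝓢(Rd d, ℂ)) (f : Lp ℂ r (volume : Measure (Rd d))) (y : Rd d) :
    lpPair φ (DomAddAct.mk y +ᵥ f) = ∫ x, φ x * f (y + x) := by
  rw [lpPair_eq_integral]
  refine integral_congr_ae ?_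
  filter_upwards [shift_ae_eq y f] with x hx
  rw [hx]

variable [Fact (r ≠ ∞)]

/-- Translation acts jointly continuously on `L^r`. This is where `r ≠ ∞` enters. -/
theorem Continuous.shift {ι : Type*} [TopologicalSpace ι] {y : ι → Rd d}
    {F : ι → Lp ℂ r (volume : Measure (Rd d))} (hy : Continuous y) (hF : Continuous F) :
    Continuous fun a => DomAddAct.mk (y a) +ᵥ F a := by
  fun_prop

theorem continuous_shift_left (f : Lp ℂ r (volume : Measure (Rd d))) :
    Continuous fun y : Rd d => DomAddAct.mk y +ᵥ f :=
  continuous_id.shift continuous_const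

theorem integrable_smul_shift {ν : Measure (Rd d)} {h : Rd d → ℂ} (hh : Integrable h ν)
    (f : Lp ℂ r (volume : Measure (Rd d))) :
    Integrable (fun y => h y • (DomAddAct.mk y +ᵥ f)) ν := by
  refine (hh.norm.mul_const ‖f‖).mono'
    (hh.1.smul (continuous_shift_left f).aestronglyMeasurable) (ae_of_all _ fun y => ?_)
  rw [norm_smul, DomAddAct.norm_vadd_Lp]

/-- The average `∫ h(y) f(y + ·) dν(y)` of the translates of `f ∈ L^r`. -/
noncomputable def shiftAverage {ν : Measure (Rd d)} {h : Rd d → ℂ} (hh : Integrable h ν) :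
    Lp ℂ r (volume : Measure (Rd d)) →L[ℂ] Lp ℂ r (volume : Measure (Rd d)) :=
  LinearMap.mkContinuous
    { toFun := fun f => ∫ y, h y • (DomAddAct.mk y +ᵥ f) ∂ν
      map_add' := fun f g => by
        simp only [DomAddAct.vadd_Lp_add, smul_add]
        exact integral_add (integrable_smul_shift hh f) (integrable_smul_shift hh g)
      map_smul' := fun c f => by
        rw [RingHom.id_apply, ← integral_smul]
        refine integral_congr_ae (ae_of_all _ fun y => ?_)
        have : (DomAddAct.mk y +ᵥ (c • f)) = c • (DomAddAct.mk y +ᵥ f) := by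
          rcases f with ⟨⟨_⟩, _⟩; rfl
        simp only [this, smul_comm (h y) c] }
    (∫ y, ‖h y‖ ∂ν) fun f => by
      refine (norm_integral_le_integral_norm _).trans (le_of_eq ?_)
      rw [← integral_mul_const]
      simp only [norm_smul, DomAddAct.norm_vadd_Lp]

theorem shiftAverage_apply {ν : Measure (Rd d)} {h : Rd d → ℂ} (hh : Integrable h ν)
    (f : Lp ℂ r (volume : Measure (Rd d))) :
    shiftAverage hh f = ∫ y, h y • (DomAddAct.mk y +ᵥ f) ∂ν := rfl

theorem lpPair_shiftAverage {ν : Measure (Rd d)} {h : Rd d → ℂ} (hh : Integrable h ν)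
    (φ : 𝓢(Rd d, ℂ)) (f : Lp ℂ r (volume : Measure (Rd d))) :
    lpPair φ (shiftAverage hh f) = ∫ y, h y * (∫ x, φ x * f (y + x)) ∂ν := by
  rw [shiftAverage_apply, ← ContinuousLinearMap.integral_comp_comm _ (integrable_smul_shift hh f)]
  simp only [map_smul, lpPair_shift, smul_eq_mul]

/-- The average of translates against a Schwartz density is a continuous function. -/
theorem shiftAverage_volume_ae_eq (κ : 𝓢(Rd d, ℂ)) (f : Lp ℂ r (volume : Measure (Rd d))) :
    shiftAverage (κ.integrable (μ := volume)) f =ᵐ[volume]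
      fun x => lpPair κ (DomAddAct.mk x +ᵥ f) := by
  have hc : Continuous fun x => lpPair κ (DomAddAct.mk x +ᵥ f) :=
    (lpPair κ).continuous.comp (continuous_shift_left f)
  have hl₁ : LocallyIntegrable (shiftAverage (κ.integrable (μ := volume)) f : Rd d → ℂ) volume :=
    (Lp.memLp _).locallyIntegrable Fact.out
  have hl₂ : LocallyIntegrable (fun x => lpPair κ (DomAddAct.mk x +ᵥ f)) volume :=
    hc.locallyIntegrable
  -- Two locally integrable functions agree if all smooth compactly supported tests do. Under the
  -- test, Fubini exchanges the roles of `κ` and the test function, because `f (y + x)` is symmetric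
  -- in `x` and `y`.
  refine ae_eq_of_integral_contDiff_smul_eq hl₁ hl₂ fun g hg hgc => ?_
  have hg₁ : HasCompactSupport (Complex.ofRealCLM ∘ g) := hgc.comp_left rfl
  have hg₂ : ContDiff ℝ (⊤ : ℕ∞) (Complex.ofRealCLM ∘ g) := by fun_prop
  set φ : 𝓢(Rd d, ℂ) := hg₁.toSchwartzMap hg₂ with hφ
  have hφx : ∀ x, φ x = (g x : ℂ) := fun x => rfl
  have hi := integrable_mul_mul_shift (κ.integrable (μ := volume)) φ f
  calc ∫ x, g x • shiftAverage (κ.integrable (μ := volume)) f x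
      = lpPair φ (shiftAverage (κ.integrable (μ := volume)) f) := by
        rw [lpPair_eq_integral]; simp [hφx]
    _ = ∫ y, ∫ x, κ y * (φ x * f (y + x)) := by
        rw [lpPair_shiftAverage]; simp only [integral_const_mul]
    _ = ∫ x, ∫ y, κ y * (φ x * f (y + x)) := integral_integral_swap hi
    _ = ∫ x, g x • lpPair κ (DomAddAct.mk x +ᵥ f) := by
        congr 1; funext x
        rw [lpPair_shift, Complex.real_smul, ← integral_const_mul, ← hφx]
        congr 1; funext y
        rw [add_comm x y]; ring

end ShiftAverage

/-! ### Averages of translates as Fourier multipliers -/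

section Multiplier

open FourierTransform

variable {d : ℕ}

/-- The Fourier transform of the complex measure `h dν`, with the sign of the inverse transform. -/
noncomputable def averageSymbol (ν : Measure (Rd d)) (h : Rd d → ℂ) (ξ : Rd d) : ℂ :=
  ∫ y, h y * Complex.exp (((2 * Real.pi * inner ℝ y ξ : ℝ) : ℂ) * Complex.I) ∂ν

theorem averageSymbol_volume (κ : 𝓢(Rd d, ℂ)) (ξ : Rd d) :
    averageSymbol volume κ ξ = (𝓕⁻ κ : 𝓢(Rd d, ℂ)) ξ := by
  rw [SchwartzMap.fourierInv_coe, Real.fourierInv_eq', averageSymbol]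
  simp only [smul_eq_mul, mul_comm]

/-- A Fourier multiplier with the symbol of `h dν` acts on Schwartz functions as an average of
translates. -/
theorem fourier_averageSymbol_mul {ν : Measure (Rd d)} [SFinite ν] {h : Rd d → ℂ}
    (hh : Integrable h ν) (hm : (averageSymbol ν h).HasTemperateGrowth) (φ : 𝓢(Rd d, ℂ))
    (x : Rd d) :
    (𝓕 (SchwartzMap.smulLeftCLM ℂ (averageSymbol ν h) (𝓕⁻ φ)) : 𝓢(Rd d, ℂ)) x =
      ∫ y, h y * φ (x - y) ∂ν := by
  set e : Rd d → Rd d → ℂ := fun v w =>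
    Complex.exp (((-2 * Real.pi * inner ℝ v w : ℝ) : ℂ) * Complex.I) with he
  -- Fourier inversion for `φ`: the character in `averageSymbol` then combines with `e ξ x` into `e
  -- ξ (x - y)`.
  have hφ : ∀ z, φ z = ∫ ξ, e ξ z * (𝓕⁻ φ : 𝓢(Rd d, ℂ)) ξ := by
    intro z
    have : φ z = (𝓕 (𝓕⁻ φ : 𝓢(Rd d, ℂ)) : 𝓢(Rd d, ℂ)) z := by
      rw [FourierTransform.fourier_fourierInv_eq]
    rw [this, SchwartzMap.fourier_coe, Real.fourier_eq']
    simp only [smul_eq_mul, he]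
  have hnorm : ∀ v w, ‖e v w‖ = 1 := fun v w => Complex.norm_exp_ofReal_mul_I _
  have h_int : Integrable (fun p : Rd d × Rd d =>
      h p.2 * (e p.1 (x - p.2) * (𝓕⁻ φ : 𝓢(Rd d, ℂ)) p.1)) (volume.prod ν) := by
    have h1 : Integrable (fun p : Rd d × Rd d => (𝓕⁻ φ : 𝓢(Rd d, ℂ)) p.1 * h p.2)
        (volume.prod ν) := (SchwartzMap.integrable _).mul_prod hh
    have h2 : Continuous fun p : Rd d × Rd d => e p.1 (x - p.2) := by
      simp only [he]; fun_prop
    refine (h1.bdd_mul (c := 1) h2.aestronglyMeasurable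
      (ae_of_all _ fun p => (hnorm _ _).le)).congr (ae_of_all _ fun p => ?_)
    simp only; ring
  rw [SchwartzMap.fourier_coe, Real.fourier_eq']
  simp only [SchwartzMap.smulLeftCLM_apply_apply hm, smul_eq_mul]
  calc ∫ ξ, e ξ x * (averageSymbol ν h ξ * (𝓕⁻ φ : 𝓢(Rd d, ℂ)) ξ)
      = ∫ ξ, ∫ y, h y * (e ξ (x - y) * (𝓕⁻ φ : 𝓢(Rd d, ℂ)) ξ) ∂ν := by
        congr 1; funext ξ
        rw [averageSymbol, ← integral_mul_const, ← integral_const_mul]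
        congr 1; funext y
        have : e ξ (x - y) =
            e ξ x * Complex.exp (((2 * Real.pi * inner ℝ y ξ : ℝ) : ℂ) * Complex.I) := by
          simp only [he]
          rw [← Complex.exp_add, inner_sub_right, real_inner_comm y ξ]
          congr 1; push_cast; ring
        rw [this]; ring
    _ = ∫ y, (∫ ξ, h y * (e ξ (x - y) * (𝓕⁻ φ : 𝓢(Rd d, ℂ)) ξ)) ∂ν :=
        integral_integral_swap h_int
    _ = ∫ y, h y * φ (x - y) ∂ν := by
        congr 1; funext y
        rw [integral_const_mul, ← hφ]

variable {r : ℝ≥0∞} [Fact (1 ≤ r)] [Fact (r ≠ ∞)]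

/-- The average of translates `f ↦ ∫ h(y) f(y + ·) dν(y)` is the Fourier multiplier with the symbol
of `h dν`. -/
theorem toTemperedDistribution_shiftAverage {ν : Measure (Rd d)} [SFinite ν] {h : Rd d → ℂ}
    (hh : Integrable h ν) (hm : (averageSymbol ν h).HasTemperateGrowth)
    (f : Lp ℂ r (volume : Measure (Rd d))) :
    (shiftAverage hh f : 𝓢'(Rd d, ℂ)) =
      TemperedDistribution.fourierMultiplierCLM ℂ (averageSymbol ν h) (f : 𝓢'(Rd d, ℂ)) := by
  ext φ
  rw [TemperedDistribution.fourierMultiplierCLM_apply_apply, ← lpPair_apply, lpPair_shiftAverage,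
    Lp.toTemperedDistribution_apply]
  simp only [fourier_averageSymbol_mul hh hm, smul_eq_mul]
  have hi := integrable_mul_mul_shift hh φ f
  have hsub : ∀ y, ∫ x, φ x * f (y + x) = ∫ x, φ (x - y) * f x := fun y => by
    have := integral_add_left_eq_self (μ := volume) (fun x => φ (x - y) * f x) y
    rw [← this]
    simp
  have hi' : Integrable (fun p : Rd d × Rd d => h p.1 * (φ (p.2 - p.1) * f p.2))
      (ν.prod volume) := by
    -- The shear `(y, x) ↦ (y, x - y)` transports the integrability of `hi` to the integrand with
    -- the translation moved onto `φ`.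
    have hmp : MeasurePreserving (fun p : Rd d × Rd d => (p.1, -p.1 + p.2)) (ν.prod volume)
        (ν.prod volume) :=
      (MeasurePreserving.id ν).skew_product (by fun_prop)
        (ae_of_all _ fun y => (measurePreserving_add_left volume (-y)).map_eq)
    refine (hmp.integrable_comp_of_integrable hi).congr (ae_of_all _ fun p => ?_)
    simp [neg_add_eq_sub]
  simp only [hsub]
  calc ∫ y, h y * (∫ x, φ (x - y) * f x) ∂ν = ∫ y, (∫ x, h y * (φ (x - y) * f x)) ∂ν := by
        simp only [integral_const_mul]
    _ = ∫ x, ∫ y, h y * (φ (x - y) * f x) ∂ν := integral_integral_swap hi'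
    _ = ∫ x, (∫ y, h y * φ (x - y) ∂ν) * f x := by
        simp only [← integral_mul_const, mul_assoc]

end Multiplier

/-! ### The Bessel potential of nonpositive order as an average of translates -/

section Bessel

/-- The Laplace transform of the gamma law. With `c = 2π²|ξ|²` it writes a negative power of `1 + c`
as a mixture of Gaussian characteristic functions. -/
theorem integral_exp_neg_mul_gammaMeasure {a c : ℝ} (ha : 0 < a) (hc : 0 ≤ c) :
    ∫ τ, Real.exp (-(c * τ)) ∂(gammaMeasure a 1) = (1 + c) ^ (-a) := by
  have hΓ := Real.Gamma_pos_of_pos ha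
  have hmeas : Measurable (gammaPDF a 1) := (measurable_gammaPDFReal a 1).ennreal_ofReal
  rw [gammaMeasure, integral_withDensity_eq_integral_toReal_smul hmeas (by simp [gammaPDF])]
  have : (fun τ => (gammaPDF a 1 τ).toReal • Real.exp (-(c * τ))) =
      (Ici (0 : ℝ)).indicator fun τ =>
        (Real.Gamma a)⁻¹ * (τ ^ (a - 1) * Real.exp (-((1 + c) * τ))) := by
    funext τ
    rw [gammaPDF, ENNReal.toReal_ofReal (gammaPDFReal_nonneg ha one_pos τ), gammaPDFReal]
    by_cases hτ : 0 ≤ τ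
    · rw [indicator_of_mem (by exact hτ), if_pos hτ, smul_eq_mul, add_mul, neg_add, Real.exp_add]
      simp; ring
    · rw [indicator_of_notMem (by exact hτ), if_neg hτ]; simp
  rw [this, integral_indicator measurableSet_Ici, integral_Ici_eq_integral_Ioi, integral_const_mul,
    Real.integral_rpow_mul_exp_neg_mul_Ioi ha (by linarith), one_div,
    Real.inv_rpow (by linarith), Real.rpow_neg (by linarith)]
  field_simp

/-- For `s ≤ 0` the symbol of `(I - Δ/2)^(s/2)` is the Fourier transform of a probability measure,
a mixture of Gaussian laws. -/
theorem exists_measure_averageSymbol_eq_sobolevSymbol (d : ℕ) {s : ℝ} (hs : s ≤ 0) :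
    ∃ μ : Measure (Rd d), IsProbabilityMeasure μ ∧
      averageSymbol μ (fun _ => 1) = fun ξ => (sobolevSymbol d s ξ : ℂ) := by
  rcases hs.eq_or_lt with rfl | hs
  -- For `s = 0` the gamma law of shape `-s/2` degenerates and the operator is the identity.
  · refine ⟨Measure.dirac 0, inferInstance, ?_⟩
    funext ξ
    simp [averageSymbol, sobolevSymbol]
  have ha : 0 < -s / 2 := by linarith
  have := isProbabilityMeasure_gammaMeasure ha one_pos
  set Γ := gammaMeasure (-s / 2) 1 with hΓ
  have hmeas : Measurable fun p : ℝ × Rd d => √p.1 • p.2 := by fun_prop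
  -- The law of `√τ Z` with `τ` gamma distributed of shape `-s/2` and `Z` an independent standard
  -- Gaussian. Given `τ`, its characteristic function at `2πξ` is `exp(-2π²|ξ|²τ)`.
  refine ⟨(Γ.prod (stdGaussian (Rd d))).map fun p => √p.1 • p.2,
    Measure.isProbabilityMeasure_map hmeas.aemeasurable, ?_⟩
  funext ξ
  have hcont : Continuous fun y : Rd d =>
      (1 : ℂ) * Complex.exp (((2 * Real.pi * inner ℝ y ξ : ℝ) : ℂ) * Complex.I) := by fun_prop
  have h_int : Integrable (fun p : ℝ × Rd d => (1 : ℂ) *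
      Complex.exp (((2 * Real.pi * inner ℝ (√p.1 • p.2) ξ : ℝ) : ℂ) * Complex.I))
      (Γ.prod (stdGaussian (Rd d))) :=
    Integrable.of_bound (hcont.measurable.comp hmeas).aestronglyMeasurable 1
      (ae_of_all _ fun p => by
        rw [one_mul]; exact (Complex.norm_exp_ofReal_mul_I _).le)
  rw [averageSymbol, integral_map hmeas.aemeasurable hcont.aestronglyMeasurable,
    integral_prod _ h_int]
  have hpos : ∀ᵐ τ ∂Γ, 0 ≤ τ := by
    have hm : Measurable (gammaPDF (-s / 2) 1) := (measurable_gammaPDFReal _ 1).ennreal_ofReal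
    rw [hΓ, gammaMeasure, ae_withDensity_iff hm]
    refine ae_of_all _ fun τ hτ => ?_
    by_contra h
    exact hτ (gammaPDF_of_neg (not_le.mp h))
  have hinner : ∀ᵐ τ ∂Γ, ∫ z, (1 : ℂ) *
      Complex.exp (((2 * Real.pi * inner ℝ (√τ • z) ξ : ℝ) : ℂ) * Complex.I) ∂stdGaussian (Rd d)
      = (Real.exp (-(2 * Real.pi ^ 2 * ‖ξ‖ ^ 2 * τ)) : ℂ) := by
    filter_upwards [hpos] with τ hτ
    have h := charFun_stdGaussian (E := Rd d) ((2 * Real.pi * √τ) • ξ)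
    rw [charFun_apply] at h
    have e1 : ∀ z : Rd d, inner ℝ z ((2 * Real.pi * √τ) • ξ) = 2 * Real.pi * inner ℝ (√τ • z) ξ := by
      intro z; rw [inner_smul_right, real_inner_smul_left]; ring
    simp only [e1] at h
    simp only [one_mul]
    rw [h, norm_smul, Complex.ofReal_exp]
    congr 1
    norm_cast
    rw [mul_pow, Real.norm_eq_abs, sq_abs, mul_pow, Real.sq_sqrt hτ]
    ring
  rw [integral_congr_ae hinner, integral_complex_ofReal, hΓ,
    integral_exp_neg_mul_gammaMeasure ha (by positivity), sobolevSymbol]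
  congr 2; ring

/-- On `L^r` the operator `(I - Δ/2)^(s/2)`, `s ≤ 0`, acts as a bounded operator. -/
theorem exists_fracPower_eq_toTemperedDistribution (d : ℕ) (r : ℝ≥0∞) [Fact (1 ≤ r)]
    [Fact (r ≠ ∞)] {s : ℝ} (hs : s ≤ 0) :
    ∃ B : Lp ℂ r (volume : Measure (Rd d)) →L[ℂ] Lp ℂ r (volume : Measure (Rd d)),
      ∀ f : Lp ℂ r (volume : Measure (Rd d)), fracPower d s (f : 𝓢'(Rd d, ℂ)) = (B f : 𝓢'(Rd d, ℂ)) := by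
  obtain ⟨μ, hμ, h⟩ := exists_measure_averageSymbol_eq_sobolevSymbol d hs
  have hi : Integrable (fun _ : Rd d => (1 : ℂ)) μ := integrable_const 1
  have hm : (averageSymbol μ fun _ => 1).HasTemperateGrowth := by
    rw [h]
    exact Complex.ofRealCLM.hasTemperateGrowth.comp (sobolevSymbol_hasTemperateGrowth d s)
  refine ⟨shiftAverage hi, fun f => ?_⟩
  rw [toTemperedDistribution_shiftAverage hi hm f, h]
  rfl

end Bessel

/-! ### Mollification in `H^s_r` -/

section Mollify

open FourierTransform

variable {d : ℕ}

theorem ofReal_sobolevSymbol_hasTemperateGrowth (d : ℕ) (s : ℝ) :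
    (fun ξ : Rd d => (sobolevSymbol d s ξ : ℂ)).HasTemperateGrowth :=
  Complex.ofRealCLM.hasTemperateGrowth.comp (sobolevSymbol_hasTemperateGrowth d s)

/-- The fractional power `(I - Δ/2)^(s/2)` on Schwartz functions, transposed to `fracPower`. -/
noncomputable def schwartzPower (d : ℕ) (s : ℝ) (φ : 𝓢(Rd d, ℂ)) : 𝓢(Rd d, ℂ) :=
  𝓕 (SchwartzMap.smulLeftCLM ℂ (fun ξ => (sobolevSymbol d s ξ : ℂ)) (𝓕⁻ φ))

theorem fracPower_apply (s : ℝ) (u : 𝓢'(Rd d, ℂ)) (φ : 𝓢(Rd d, ℂ)) :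
    fracPower d s u φ = u (schwartzPower d s φ) := rfl

theorem fourierInv_compSubConst (x : Rd d) (φ : 𝓢(Rd d, ℂ)) (ξ : Rd d) :
    (𝓕⁻ (φ.compSubConstCLM ℂ x) : 𝓢(Rd d, ℂ)) ξ =
      Complex.exp (((2 * Real.pi * inner ℝ x ξ : ℝ) : ℂ) * Complex.I) *
        (𝓕⁻ φ : 𝓢(Rd d, ℂ)) ξ := by
  rw [SchwartzMap.fourierInv_coe, SchwartzMap.fourierInv_coe, Real.fourierInv_eq',
    Real.fourierInv_eq', ← integral_const_mul]
  have h := integral_add_left_eq_self (μ := volume) (fun v : Rd d =>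
    Complex.exp (((2 * Real.pi * inner ℝ v ξ : ℝ) : ℂ) * Complex.I) •
      φ.compSubConstCLM ℂ x v) x
  rw [← h]
  congr 1; funext v
  rw [SchwartzMap.compSubConstCLM_apply, add_sub_cancel_left, inner_add_left, smul_eq_mul,
    smul_eq_mul, ← mul_assoc, ← Complex.exp_add]
  congr 2; push_cast; ring

/-- Fourier multipliers commute with translations, since a translation only multiplies the inverse
transform by a character. -/
theorem schwartzPower_compSubConst (s : ℝ) (x : Rd d) (φ : 𝓢(Rd d, ℂ)) :
    schwartzPower d s (φ.compSubConstCLM ℂ x) = (schwartzPower d s φ).compSubConstCLM ℂ x := by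
  ext z
  rw [SchwartzMap.compSubConstCLM_apply, schwartzPower, schwartzPower, SchwartzMap.fourier_coe,
    SchwartzMap.fourier_coe, Real.fourier_eq', Real.fourier_eq']
  congr 1; funext ξ
  simp only [SchwartzMap.smulLeftCLM_apply_apply (ofReal_sobolevSymbol_hasTemperateGrowth d s),
    fourierInv_compSubConst, smul_eq_mul]
  have : Complex.exp (((-2 * Real.pi * inner ℝ ξ (z - x) : ℝ) : ℂ) * Complex.I) =
      Complex.exp (((-2 * Real.pi * inner ℝ ξ z : ℝ) : ℂ) * Complex.I) *
      Complex.exp (((2 * Real.pi * inner ℝ x ξ : ℝ) : ℂ) * Complex.I) := by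
    rw [← Complex.exp_add, inner_sub_right, real_inner_comm x ξ]
    congr 1; push_cast; ring
  rw [this]; ring

theorem averageSymbol_schwartzPower (s : ℝ) (φ : 𝓢(Rd d, ℂ)) :
    averageSymbol volume (schwartzPower d s φ) =
      averageSymbol volume φ * fun ξ => (sobolevSymbol d s ξ : ℂ) := by
  funext ξ
  rw [averageSymbol_volume, schwartzPower, FourierTransform.fourierInv_fourier_eq, Pi.mul_apply,
    averageSymbol_volume,
    SchwartzMap.smulLeftCLM_apply_apply (ofReal_sobolevSymbol_hasTemperateGrowth d s), smul_eq_mul,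
    mul_comm]

theorem averageSymbol_volume_hasTemperateGrowth (φ : 𝓢(Rd d, ℂ)) :
    (averageSymbol volume φ).HasTemperateGrowth := by
  have : averageSymbol volume φ = (𝓕⁻ φ : 𝓢(Rd d, ℂ)) := funext (averageSymbol_volume φ)
  rw [this]
  exact SchwartzMap.hasTemperateGrowth _

/-- The mollifier of a bump function, as a Schwartz function. -/
noncomputable def mollifier (b : ContDiffBump (0 : Rd d)) : 𝓢(Rd d, ℂ) :=
  HasCompactSupport.toSchwartzMap (f := Complex.ofRealCLM ∘ b.normed volume)
    (b.hasCompactSupport_normed.comp_left rfl)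
    (Complex.ofRealCLM.contDiff.comp b.contDiff_normed)

theorem mollifier_apply (b : ContDiffBump (0 : Rd d)) (x : Rd d) :
    mollifier b x = (b.normed volume x : ℂ) := rfl

variable {r : ℝ≥0∞} [Fact (1 ≤ r)]

theorem fracPower_apply_compSubConst (s : ℝ) (f : Lp ℂ r (volume : Measure (Rd d)))
    (φ : 𝓢(Rd d, ℂ)) (x : Rd d) :
    fracPower d s (f : 𝓢'(Rd d, ℂ)) (φ.compSubConstCLM ℂ x) =
      lpPair (schwartzPower d s φ) (DomAddAct.mk x +ᵥ f) := by
  rw [fracPower_apply, schwartzPower_compSubConst, ← lpPair_apply, lpPair_eq_integral,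
    lpPair_shift]
  rw [← integral_add_left_eq_self (μ := volume) _ x]
  simp

/-- The smooth function `x ↦ u(φ(· - x))`, in terms of `(I - Δ/2)^(s/2) u ∈ L^r`. -/
theorem Sobolev.apply_compSubConst {s : ℝ} (w : Sobolev d s r) (φ : 𝓢(Rd d, ℂ)) (x : Rd d) :
    Sobolev.toDistribution d s r w (φ.compSubConstCLM ℂ x) =
      lpPair (schwartzPower d (-s) φ) (DomAddAct.mk x +ᵥ w.toLp) := by
  rw [← fracPower_neg_fracPower d s (Sobolev.toDistribution d s r w), Sobolev.toLp_spec,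
    fracPower_apply_compSubConst]

variable [Fact (r ≠ ∞)]

/-- Composition multiplies symbols, so a fractional power may sit on the density or on the average.
It is valid for every real `s` because the density stays Schwartz. -/
theorem toTemperedDistribution_shiftAverage_schwartzPower (s : ℝ) (φ : 𝓢(Rd d, ℂ))
    (f : Lp ℂ r (volume : Measure (Rd d))) :
    (shiftAverage ((schwartzPower d s φ).integrable (μ := volume)) f : 𝓢'(Rd d, ℂ)) =
      fracPower d s (shiftAverage (φ.integrable (μ := volume)) f : 𝓢'(Rd d, ℂ)) := by
  rw [toTemperedDistribution_shiftAverage _ (averageSymbol_volume_hasTemperateGrowth _),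
    toTemperedDistribution_shiftAverage _ (averageSymbol_volume_hasTemperateGrowth _),
    averageSymbol_schwartzPower, fracPower,
    TemperedDistribution.fourierMultiplierCLM_fourierMultiplierCLM_apply
      (averageSymbol_volume_hasTemperateGrowth _) (ofReal_sobolevSymbol_hasTemperateGrowth d s)]

/-- The powers `s` and `-s` cancel: seen through `(I - Δ/2)^(s/2)`, mollifying a distribution is
plain mollification of its `L^r` representative. -/
theorem bessel_shiftAverage_schwartzPower {s : ℝ}
    {B : Lp ℂ r (volume : Measure (Rd d)) →L[ℂ] Lp ℂ r (volume : Measure (Rd d))}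
    (hB : ∀ f : Lp ℂ r (volume : Measure (Rd d)),
      fracPower d s (f : 𝓢'(Rd d, ℂ)) = (B f : 𝓢'(Rd d, ℂ)))
    (φ : 𝓢(Rd d, ℂ)) (f : Lp ℂ r (volume : Measure (Rd d))) :
    B (shiftAverage ((schwartzPower d (-s) φ).integrable (μ := volume)) f) =
      shiftAverage (φ.integrable (μ := volume)) f := by
  apply Sobolev.toTemperedDistribution_injective
  simp only [Lp.toTemperedDistributionCLM_apply]
  rw [← hB, toTemperedDistribution_shiftAverage_schwartzPower]
  have := fracPower_neg_fracPower d (-s)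
    (shiftAverage (φ.integrable (μ := volume)) f : 𝓢'(Rd d, ℂ))
  rwa [neg_neg] at this

/-- The mollifier is a probability density on the ball of radius `rOut`, so the error is an average
of the translation errors `f(y + ·) - f`. -/
theorem norm_shiftAverage_mollifier_sub_le (b : ContDiffBump (0 : Rd d))
    (f : Lp ℂ r (volume : Measure (Rd d))) {ε : ℝ}
    (hε : ∀ y : Rd d, ‖y‖ < b.rOut → ‖(DomAddAct.mk y +ᵥ f) - f‖ ≤ ε) :
    ‖shiftAverage ((mollifier b).integrable (μ := volume)) f - f‖ ≤ ε := by
  have h1 : ∫ y, mollifier b y • f = f := by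
    rw [integral_smul_const]
    simp only [mollifier_apply]
    rw [integral_complex_ofReal, b.integral_normed]; simp
  have h2 : shiftAverage ((mollifier b).integrable (μ := volume)) f - f =
      ∫ y, mollifier b y • ((DomAddAct.mk y +ᵥ f) - f) := by
    simp only [smul_sub]
    rw [integral_sub (integrable_smul_shift (mollifier b).integrable f)
      ((mollifier b).integrable.smul_const f), h1, shiftAverage_apply]
  rw [h2]
  calc _ ≤ ∫ y, b.normed volume y * ε := by
        refine norm_integral_le_of_norm_le (b.integrable_normed.mul_const ε)
          (ae_of_all _ fun y => ?_)
        rw [norm_smul, mollifier_apply, Complex.norm_real, Real.norm_of_nonneg (b.nonneg_normed y)]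
        by_cases hy : ‖y‖ < b.rOut
        · exact mul_le_mul_of_nonneg_left (hε y hy) (b.nonneg_normed y)
        · have : b.normed volume y = 0 := by
            rw [← Function.notMem_support, b.support_normed_eq]
            simpa using hy
          simp [this]
    _ = ε := by rw [integral_mul_const, b.integral_normed, one_mul]

end Mollify

/-! ### Spatial cutoff -/

section Cutoff

variable {d : ℕ}

/-- A continuous cutoff function, equal to `1` on the ball of radius `R` and to `0` outside the
ball of radius `R + 1`. -/
noncomputable def cutoff (R : ℝ) (x : Rd d) : ℝ := max 0 (min 1 (R + 1 - ‖x‖))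

theorem continuous_cutoff (R : ℝ) : Continuous (cutoff R : Rd d → ℝ) := by
  unfold cutoff; fun_prop

theorem cutoff_nonneg (R : ℝ) (x : Rd d) : 0 ≤ cutoff R x := le_max_left _ _

theorem cutoff_le_one (R : ℝ) (x : Rd d) : cutoff R x ≤ 1 :=
  max_le zero_le_one (min_le_left _ _)

theorem cutoff_eq_one {R : ℝ} {x : Rd d} (h : ‖x‖ ≤ R) : cutoff R x = 1 := by
  rw [cutoff, min_eq_left (by linarith), max_eq_right zero_le_one]

theorem cutoff_eq_zero {R : ℝ} {x : Rd d} (h : R + 1 ≤ ‖x‖) : cutoff R x = 0 := by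
  rw [cutoff, max_eq_left]
  exact (min_le_right _ _).trans (by linarith)

theorem norm_cutoff_le (R : ℝ) (x : Rd d) : ‖(cutoff R x : ℂ)‖ ≤ 1 := by
  rw [Complex.norm_real, Real.norm_of_nonneg (cutoff_nonneg R x)]
  exact cutoff_le_one R x

theorem memLp_cutoff (R : ℝ) :
    MemLp (fun x : Rd d => (cutoff R x : ℂ)) ∞ (volume : Measure (Rd d)) :=
  memLp_top_of_bound
    (Complex.continuous_ofReal.comp (continuous_cutoff R)).aestronglyMeasurable 1
    (ae_of_all _ (norm_cutoff_le R))

variable {r : ℝ≥0∞} [Fact (1 ≤ r)]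

/-- Multiplication by the cutoff function on `L^r`. -/
noncomputable def cutoffLp (R : ℝ) :
    Lp ℂ r (volume : Measure (Rd d)) →L[ℂ] Lp ℂ r (volume : Measure (Rd d)) :=
  (ContinuousLinearMap.mul ℂ ℂ).holderL volume ∞ r r ((memLp_cutoff R).toLp _)

theorem cutoffLp_ae_eq (R : ℝ) (f : Lp ℂ r (volume : Measure (Rd d))) :
    cutoffLp R f =ᵐ[volume] fun x => (cutoff R x : ℂ) * f x := by
  filter_upwards [(ContinuousLinearMap.mul ℂ ℂ).coeFn_holder (r := r) ((memLp_cutoff R).toLp _) f,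
    (memLp_cutoff (d := d) R).coeFn_toLp] with x h1 h2
  rw [ContinuousLinearMap.mul_apply', h2] at h1
  exact h1

theorem norm_cutoffLp_apply_le (R : ℝ) (f : Lp ℂ r (volume : Measure (Rd d))) :
    ‖cutoffLp R f‖ ≤ ‖f‖ := by
  refine Lp.norm_le_norm_of_ae_le ?_
  filter_upwards [cutoffLp_ae_eq R f] with x hx
  rw [hx, norm_mul]
  exact mul_le_of_le_one_left (norm_nonneg _) (norm_cutoff_le R x)

variable [hr : Fact (r ≠ ∞)]

/-- Compactly supported functions are dense and are fixed by large cutoffs. Since cutoffs are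
contractions, the convergence extends to all of `L^r`. -/
theorem tendsto_cutoffLp (f : Lp ℂ r (volume : Measure (Rd d))) :
    Tendsto (fun R => cutoffLp R f) atTop (𝓝 f) := by
  rw [Metric.tendsto_nhds]
  intro ε hε
  obtain ⟨g, hgc, hg, -, hgm⟩ := (Lp.memLp f).exists_hasCompactSupport_eLpNorm_sub_le hr.out
    (ε := ENNReal.ofReal (ε / 3)) (by simpa using hε)
  set G := hgm.toLp g with hG
  have hfG : ‖f - G‖ ≤ ε / 3 := by
    rw [Lp.norm_def]
    refine ENNReal.toReal_le_of_le_ofReal (by positivity) (le_trans (le_of_eq ?_) hg)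
    refine eLpNorm_congr_ae ?_
    filter_upwards [Lp.coeFn_sub f G, hgm.coeFn_toLp] with x h1 h2
    rw [h1, Pi.sub_apply, Pi.sub_apply, h2]
  obtain ⟨R₀, hR₀⟩ := hgc.isCompact.isBounded.subset_closedBall (0 : Rd d)
  filter_upwards [eventually_ge_atTop R₀] with R hR
  have hGR : cutoffLp R G = G := by
    ext1
    filter_upwards [cutoffLp_ae_eq R G, hgm.coeFn_toLp] with x h1 h2
    rw [h1, h2]
    by_cases hx : x ∈ tsupport g
    · have : ‖x‖ ≤ R := by
        have := hR₀ hx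
        rw [mem_closedBall_zero_iff] at this
        exact this.trans hR
      rw [cutoff_eq_one this]; simp
    · rw [image_eq_zero_of_notMem_tsupport hx, mul_zero]
  have e : cutoffLp R f - f = cutoffLp R (f - G) - (f - G) := by
    rw [map_sub, hGR]; abel
  rw [dist_eq_norm, e]
  calc _ ≤ ‖cutoffLp R (f - G)‖ + ‖f - G‖ := norm_sub_le _ _
    _ ≤ ε / 3 + ε / 3 := add_le_add ((norm_cutoffLp_apply_le _ _).trans hfG) hfG
    _ < ε := by linarith

/-- Contractions that converge pointwise converge uniformly on compact sets. Near `t`, the variation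
of `F` is counted twice, before and after the cutoff, hence the `ε / 3`. -/
theorem eventually_forall_norm_cutoffLp_sub_le {ι : Type*} [TopologicalSpace ι] [CompactSpace ι]
    {F : ι → Lp ℂ r (volume : Measure (Rd d))} (hF : Continuous F) {ε : ℝ} (hε : 0 < ε) :
    ∀ᶠ R in atTop, ∀ t, ‖cutoffLp R (F t) - F t‖ ≤ ε := by
  have := isCompact_univ.induction_on (X := ι)
    (p := fun S => ∀ᶠ R in atTop, ∀ t ∈ S, ‖cutoffLp R (F t) - F t‖ ≤ ε)
    (by simp) (fun S S' h h' => h'.mono fun R hR t ht => hR t (h ht))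
    (fun S S' h h' => by
      filter_upwards [h, h'] with R h1 h2 t ht
      exact ht.elim (h1 t) (h2 t))
    (fun t _ => by
      refine ⟨F ⁻¹' Metric.ball (F t) (ε / 3), ?_, ?_⟩
      · rw [nhdsWithin_univ]
        exact hF.continuousAt (Metric.ball_mem_nhds _ (by positivity))
      · filter_upwards [(tendsto_cutoffLp (F t)).eventually
          (Metric.ball_mem_nhds _ (show 0 < ε / 3 by positivity))] with R hR t' ht'
        have h1 : ‖cutoffLp R (F t) - F t‖ < ε / 3 := by simpa [dist_eq_norm] using hR
        have h2 : ‖F t' - F t‖ < ε / 3 := by simpa [dist_eq_norm] using ht'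
        have e : cutoffLp R (F t') - F t' =
            cutoffLp R (F t' - F t) + (cutoffLp R (F t) - F t) - (F t' - F t) := by
          rw [map_sub]; abel
        rw [e]
        have h3 := norm_sub_le (cutoffLp R (F t' - F t) + (cutoffLp R (F t) - F t)) (F t' - F t)
        have h4 := norm_add_le (cutoffLp R (F t' - F t)) (cutoffLp R (F t) - F t)
        have h5 := norm_cutoffLp_apply_le R (F t' - F t)
        linarith)
  simpa using this

end Cutoff

/-! ### Approximation of `C([0,T]; H^s_r)` by continuous functions of compact support -/

section Approximation

variable {d : ℕ} {s : ℝ} {r : ℝ≥0∞} [Fact (1 ≤ r)]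

namespace Sobolev

theorem norm_def (w : Sobolev d s r) : ‖w‖ = ‖w.toLp‖ := rfl

theorem toLp_sub (w w' : Sobolev d s r) : (w - w').toLp = w.toLp - w'.toLp :=
  map_sub (toLpHom d s r) w w'

theorem continuous_toLp : Continuous (toLp : Sobolev d s r → _) := by
  refine (Isometry.of_dist_eq fun w w' => ?_).continuous
  rw [dist_eq_norm, dist_eq_norm, norm_def, toLp_sub]

/-- The mollification `x ↦ ∫ ρ(x - y) w(y) dy` of `w ∈ H^s_r`. -/
noncomputable def mollify (b : ContDiffBump (0 : Rd d)) (w : Sobolev d s r) (x : Rd d) : ℝ :=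
  (toDistribution d s r w ((mollifier b).compSubConstCLM ℂ x)).re

theorem ofReal_mollify (b : ContDiffBump (0 : Rd d)) (w : Sobolev d s r) (x : Rd d) :
    (mollify b w x : ℂ) = toDistribution d s r w ((mollifier b).compSubConstCLM ℂ x) := by
  have h : (toDistribution d s r w ((mollifier b).compSubConstCLM ℂ x)).im = 0 :=
    w.2.1 _ fun y => by
      rw [SchwartzMap.compSubConstCLM_apply, mollifier_apply, Complex.ofReal_im]
  rw [mollify]
  exact Complex.ext rfl (by rw [Complex.ofReal_im, h])

/-- A real function in `L^r` as an element of `H^s_r`, `s ≤ 0`. -/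
noncomputable def ofLp [Fact (r ≠ ∞)] (hs : s ≤ 0) (w : Lp ℂ r (volume : Measure (Rd d)))
    (hw : ∀ᵐ x, (w x).im = 0) : Sobolev d s r :=
  ⟨(w : 𝓢'(Rd d, ℂ)), fun φ hφ => by
    have h : (w : 𝓢'(Rd d, ℂ)) φ = ∫ x, (((φ x).re * (w x).re : ℝ) : ℂ) := by
      rw [Lp.toTemperedDistribution_apply]
      refine integral_congr_ae ?_
      filter_upwards [hw] with x hx
      rw [smul_eq_mul]
      apply Complex.ext <;> simp [hφ x, hx]
    rw [h, integral_complex_ofReal, Complex.ofReal_im],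
    let ⟨B, hB⟩ := exists_fracPower_eq_toTemperedDistribution d r hs
    ⟨B w, hB w⟩⟩

variable [Fact (r ≠ ∞)]

theorem toDistribution_ofLp (hs : s ≤ 0) (w : Lp ℂ r (volume : Measure (Rd d)))
    (hw : ∀ᵐ x, (w x).im = 0) :
    toDistribution d s r (ofLp hs w hw) = (w : 𝓢'(Rd d, ℂ)) := rfl

theorem toLp_ofLp (hs : s ≤ 0)
    {B : Lp ℂ r (volume : Measure (Rd d)) →L[ℂ] Lp ℂ r (volume : Measure (Rd d))}
    (hB : ∀ f : Lp ℂ r (volume : Measure (Rd d)),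
      fracPower d s (f : 𝓢'(Rd d, ℂ)) = (B f : 𝓢'(Rd d, ℂ)))
    (w : Lp ℂ r (volume : Measure (Rd d))) (hw : ∀ᵐ x, (w x).im = 0) :
    (ofLp hs w hw).toLp = B w := by
  apply toTemperedDistribution_injective
  simp only [Lp.toTemperedDistributionCLM_apply]
  rw [← toLp_spec, ← hB, toDistribution_ofLp]

/-- The product of the cutoff function and the mollification of `w`, in `L^r`. -/
noncomputable def regularizeLp (b : ContDiffBump (0 : Rd d)) (R : ℝ) (w : Sobolev d s r) :
    Lp ℂ r (volume : Measure (Rd d)) :=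
  cutoffLp R
    (shiftAverage ((schwartzPower d (-s) (mollifier b)).integrable (μ := volume)) w.toLp)

theorem regularizeLp_ae_eq (b : ContDiffBump (0 : Rd d)) (R : ℝ) (w : Sobolev d s r) :
    regularizeLp b R w =ᵐ[volume] fun x => ((cutoff R x * mollify b w x : ℝ) : ℂ) := by
  filter_upwards [cutoffLp_ae_eq R (shiftAverage
    ((schwartzPower d (-s) (mollifier b)).integrable (μ := volume)) w.toLp),
    shiftAverage_volume_ae_eq (schwartzPower d (-s) (mollifier b)) w.toLp] with x h1 h2
  rw [regularizeLp, h1, h2, ← apply_compSubConst, ← ofReal_mollify, Complex.ofReal_mul]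

theorem regularizeLp_im (b : ContDiffBump (0 : Rd d)) (R : ℝ) (w : Sobolev d s r) :
    ∀ᵐ x, (regularizeLp b R w x).im = 0 := by
  filter_upwards [regularizeLp_ae_eq b R w] with x hx
  rw [hx, Complex.ofReal_im]

/-- The product of the cutoff function and the mollification of `w`, in `H^s_r`. -/
noncomputable def regularize (hs : s ≤ 0) (b : ContDiffBump (0 : Rd d)) (R : ℝ)
    (w : Sobolev d s r) : Sobolev d s r :=
  ofLp hs (regularizeLp b R w) (regularizeLp_im b R w)

theorem toDistribution_regularize (hs : s ≤ 0) (b : ContDiffBump (0 : Rd d)) (R : ℝ)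
    (w : Sobolev d s r) (φ : 𝓢(Rd d, ℂ)) :
    toDistribution d s r (regularize hs b R w) φ =
      ∫ x, φ x * ((cutoff R x * mollify b w x : ℝ) : ℂ) := by
  rw [regularize, toDistribution_ofLp, Lp.toTemperedDistribution_apply]
  refine integral_congr_ae ?_
  filter_upwards [regularizeLp_ae_eq b R w] with x hx
  rw [hx, smul_eq_mul]

theorem continuous_regularize (hs : s ≤ 0) (b : ContDiffBump (0 : Rd d)) (R : ℝ) :
    Continuous (regularize hs b R : Sobolev d s r → Sobolev d s r) := by
  obtain ⟨B, hB⟩ := exists_fracPower_eq_toTemperedDistribution d r hs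
  have hi : Topology.IsInducing (toLp : Sobolev d s r → Lp ℂ r (volume : Measure (Rd d))) := by
    refine (Isometry.of_dist_eq fun w w' => ?_).isUniformInducing.isInducing
    rw [dist_eq_norm, dist_eq_norm, norm_def, toLp_sub]
  rw [hi.continuous_iff]
  have : toLp ∘ (regularize hs b R : Sobolev d s r → Sobolev d s r) =
      fun w => B (regularizeLp b R w) := funext fun w => toLp_ofLp hs hB _ _
  rw [this]
  exact B.continuous.comp ((cutoffLp R).continuous.comp
    ((shiftAverage _).continuous.comp continuous_toLp))

/-- Joint continuity in the distribution and the point makes the regularization a continuous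
function on `[0,T] × ℝ^d`. -/
theorem continuous_mollify (b : ContDiffBump (0 : Rd d)) :
    Continuous fun p : Sobolev d s r × Rd d => mollify b p.1 p.2 := by
  simp only [mollify, apply_compSubConst]
  exact Complex.continuous_re.comp ((lpPair _).continuous.comp
    (continuous_snd.shift (continuous_toLp.comp continuous_fst)))

/-- Splits the error into the cutoff error, taken in `L^r` and passed through `B`, and the
mollification error of `w.toLp`. The first involves a density that depends on `b`, so `R` has to be
chosen after `b`. -/
theorem norm_regularize_sub_le (hs : s ≤ 0)
    {B : Lp ℂ r (volume : Measure (Rd d)) →L[ℂ] Lp ℂ r (volume : Measure (Rd d))}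
    (hB : ∀ f : Lp ℂ r (volume : Measure (Rd d)),
      fracPower d s (f : 𝓢'(Rd d, ℂ)) = (B f : 𝓢'(Rd d, ℂ)))
    (b : ContDiffBump (0 : Rd d)) (R : ℝ) (w : Sobolev d s r) :
    ‖regularize hs b R w - w‖ ≤
      ‖B‖ * ‖cutoffLp R (shiftAverage ((schwartzPower d (-s) (mollifier b)).integrable
          (μ := volume)) w.toLp) -
        shiftAverage ((schwartzPower d (-s) (mollifier b)).integrable (μ := volume)) w.toLp‖ +
      ‖shiftAverage ((mollifier b).integrable (μ := volume)) w.toLp - w.toLp‖ := by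
  rw [norm_def, toLp_sub, regularize, toLp_ofLp hs hB, regularizeLp,
    ← bessel_shiftAverage_schwartzPower hB (mollifier b) w.toLp]
  refine le_trans (le_of_eq ?_) ((norm_add_le _ _).trans
    (add_le_add_left (B.le_opNorm _) _))
  rw [map_sub]; congr 1; abel

end Sobolev

variable {T : ℝ}

/-- The function of compact support given by mollification and cutoff. -/
noncomputable def regularizeFun (b : ContDiffBump (0 : Rd d)) (R : ℝ)
    (u : C(Icc (0 : ℝ) T, SobolevVec d s r)) (t : ℝ) (x : Rd d) : Rd d :=
  open Classical in
  if ht : t ∈ Icc (0 : ℝ) T then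
    WithLp.toLp 2 fun i => cutoff R x * Sobolev.mollify b (u ⟨t, ht⟩ i) x
  else 0

theorem regularizeFun_apply (b : ContDiffBump (0 : Rd d)) (R : ℝ)
    (u : C(Icc (0 : ℝ) T, SobolevVec d s r)) {t : ℝ} (ht : t ∈ Icc (0 : ℝ) T) (x : Rd d)
    (i : Fin d) :
    regularizeFun b R u t x i = cutoff R x * Sobolev.mollify b (u ⟨t, ht⟩ i) x := by
  rw [regularizeFun, dif_pos ht]

variable [Fact (r ≠ ∞)]

/-- The tube lemma for the jointly continuous error, which vanishes at `y = 0`. -/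
theorem eventually_forall_norm_shift_sub_le {ι : Type*} [TopologicalSpace ι] [CompactSpace ι]
    {F : ι → Lp ℂ r (volume : Measure (Rd d))} (hF : Continuous F) {ε : ℝ} (hε : 0 < ε) :
    ∀ᶠ y in 𝓝 (0 : Rd d), ∀ t, ‖(DomAddAct.mk y +ᵥ F t) - F t‖ ≤ ε := by
  have hc : Continuous fun p : Rd d × ι => ‖(DomAddAct.mk p.1 +ᵥ F p.2) - F p.2‖ :=
    ((continuous_fst.shift (hF.comp continuous_snd)).sub (hF.comp continuous_snd)).norm
  have := isCompact_univ.eventually_forall_of_forall_eventually (x₀ := (0 : Rd d)) (K := univ)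
    (P := fun y t => ‖(DomAddAct.mk y +ᵥ F t) - F t‖ ≤ ε) fun t _ => by
      have h0 : ‖(DomAddAct.mk (0 : Rd d) +ᵥ F t) - F t‖ < ε := by
        rw [DomAddAct.mk_zero, zero_vadd, sub_self, norm_zero]; exact hε
      have ho : IsOpen {p : Rd d × ι | ‖(DomAddAct.mk p.1 +ᵥ F p.2) - F p.2‖ < ε} :=
        isOpen_lt hc continuous_const
      filter_upwards [ho.mem_nhds (show ((0 : Rd d), t) ∈ _ from h0)] with z hz using le_of_lt hz
  simpa using this

/-- A sequence of bump functions at the origin, with radii tending to `0`. -/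
noncomputable def bumpSeq (d : ℕ) (n : ℕ) : ContDiffBump (0 : Rd d) where
  rIn := 1 / (2 * ((n : ℝ) + 1))
  rOut := 1 / ((n : ℝ) + 1)
  rIn_pos := by positivity
  rIn_lt_rOut := by
    apply one_div_lt_one_div_of_lt <;> linarith [n.cast_nonneg (α := ℝ)]

theorem bumpSeq_rOut_le_one (d n : ℕ) : (bumpSeq d n).rOut ≤ 1 :=
  div_le_one_of_le₀ (by linarith [n.cast_nonneg (α := ℝ)]) (by positivity)

theorem tendsto_bumpSeq_rOut (d : ℕ) : Tendsto (fun n => (bumpSeq d n).rOut) atTop (𝓝 0) :=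
  tendsto_one_div_add_atTop_nhds_zero_nat

/-- A bounded ratio of radii is what almost everywhere convergence of the convolutions requires. -/
theorem bumpSeq_rOut_le (d n : ℕ) : (bumpSeq d n).rOut ≤ 2 * (bumpSeq d n).rIn := by
  simp only [bumpSeq]
  apply le_of_eq
  field_simp

/-- The regularization of an element of `C([0,T]; H^s_r)`, by mollification and cutoff. -/
noncomputable def regularizeMap (hs : s ≤ 0) (b : ContDiffBump (0 : Rd d)) (R : ℝ)
    (u : C(Icc (0 : ℝ) T, SobolevVec d s r)) : C(Icc (0 : ℝ) T, SobolevVec d s r) where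
  toFun t i := Sobolev.regularize hs b R (u t i)
  continuous_toFun := continuous_pi fun i =>
    (Sobolev.continuous_regularize hs b R).comp ((continuous_apply i).comp u.continuous)

theorem isContinuousCompactSupport_regularizeFun (b : ContDiffBump (0 : Rd d)) (R : ℝ)
    (u : C(Icc (0 : ℝ) T, SobolevVec d s r)) :
    IsContinuousCompactSupport T (regularizeFun b R u) := by
  refine ⟨?_, Metric.closedBall 0 (R + 1), isCompact_closedBall _ _, fun t ht x hx => ?_⟩
  · rw [continuousOn_iff_continuous_domRestrict]
    have h : Continuous fun p : ↥(Icc (0 : ℝ) T ×ˢ (univ : Set (Rd d))) =>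
        (WithLp.toLp 2 fun i =>
          cutoff R p.1.2 * Sobolev.mollify b (u ⟨p.1.1, p.2.1⟩ i) p.1.2 : Rd d) := by
      refine (PiLp.continuous_toLp 2 _).comp (continuous_pi fun i => ?_)
      refine ((continuous_cutoff R).comp (continuous_snd.comp continuous_subtype_val)).mul ?_
      refine (Sobolev.continuous_mollify b).comp (Continuous.prodMk ?_ ?_)
      · exact (continuous_apply i).comp (u.continuous.comp
          ((continuous_fst.comp continuous_subtype_val).subtype_mk _))
      · exact continuous_snd.comp continuous_subtype_val
    refine h.congr fun p => ?_
    ext i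
    exact (regularizeFun_apply b R u p.2.1 p.1.2 i).symm
  · ext i
    rw [regularizeFun_apply b R u ht, cutoff_eq_zero, zero_mul]
    · rfl
    · simpa using (not_le.mp (by simpa using hx)).le

theorem isGivenBy_regularizeMap (hs : s ≤ 0) (b : ContDiffBump (0 : Rd d)) (R : ℝ)
    (u : C(Icc (0 : ℝ) T, SobolevVec d s r)) :
    IsGivenBy (regularizeMap hs b R u) (regularizeFun b R u) := by
  refine ae_of_all _ fun t ht i φ _ => ?_
  simp only [regularizeFun_apply b R u ht]
  exact Sobolev.toDistribution_regularize hs b R (u ⟨t, ht⟩ i) φ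

theorem exists_dist_regularizeMap_le (hs : s ≤ 0) (u : C(Icc (0 : ℝ) T, SobolevVec d s r))
    {ε : ℝ} (hε : 0 < ε) :
    ∀ᶠ n in atTop, ∀ᶠ R in atTop, dist (regularizeMap hs (bumpSeq d n) R u) u ≤ ε := by
  obtain ⟨B, hB⟩ := exists_fracPower_eq_toTemperedDistribution d r hs
  have hF : ∀ i, Continuous fun t => (u t i).toLp := fun i =>
    Sobolev.continuous_toLp.comp ((continuous_apply i).comp u.continuous)
  have hshift : ∀ᶠ y in 𝓝 (0 : Rd d), ∀ i t,
      ‖(DomAddAct.mk y +ᵥ (u t i).toLp) - (u t i).toLp‖ ≤ ε / 2 :=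
    eventually_all.mpr fun i => eventually_forall_norm_shift_sub_le (hF i) (half_pos hε)
  obtain ⟨δ, hδ, hball⟩ := Metric.eventually_nhds_iff.mp hshift
  filter_upwards [(tendsto_bumpSeq_rOut d).eventually_lt_const hδ] with n hn
  set κ := schwartzPower d (-s) (mollifier (bumpSeq d n)) with hκ
  -- The factor `1 / (‖B‖ + 1)` absorbs `B` and avoids dividing by zero.
  have hcut : ∀ᶠ R in atTop, ∀ i t,
      ‖cutoffLp R (shiftAverage (κ.integrable (μ := volume)) (u t i).toLp) -
        shiftAverage (κ.integrable (μ := volume)) (u t i).toLp‖ ≤ ε / 2 / (‖B‖ + 1) :=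
    eventually_all.mpr fun i => eventually_forall_norm_cutoffLp_sub_le
      ((shiftAverage (κ.integrable (μ := volume))).continuous.comp (hF i)) (by positivity)
  filter_upwards [hcut] with R hR
  rw [ContinuousMap.dist_le hε.le]
  intro t
  rw [dist_pi_le_iff hε.le]
  intro i
  rw [dist_eq_norm]
  refine (Sobolev.norm_regularize_sub_le hs hB (bumpSeq d n) R (u t i)).trans ?_
  have h1 := norm_shiftAverage_mollifier_sub_le (bumpSeq d n) (u t i).toLp
    (fun y hy => hball (by rw [dist_zero_right]; exact hy.trans hn) i t)
  have h2 : ‖B‖ * (ε / 2 / (‖B‖ + 1)) ≤ ε / 2 := by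
    rw [mul_div_assoc', div_le_iff₀ (by positivity)]
    nlinarith [norm_nonneg B]
  have h3 := mul_le_mul_of_nonneg_left (hR i t) (norm_nonneg B)
  linarith

/-- Regularizations converge in `C([0,T]; H^s_r)`, for suitable cutoff radii. -/
theorem exists_tendsto_regularizeMap (hs : s ≤ 0) (u : C(Icc (0 : ℝ) T, SobolevVec d s r)) :
    ∃ R : ℕ → ℝ, Tendsto R atTop atTop ∧
      Tendsto (fun n => regularizeMap hs (bumpSeq d n) (R n) u) atTop (𝓝 u) := by
  -- Diagonal choice: one `R n ≥ n` attains every accuracy `1 / (m + 1)`, `m ≤ n`, that large radii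
  -- attain for this `n`.
  have hsel : ∀ n : ℕ, ∃ R : ℝ, (n : ℝ) ≤ R ∧ ∀ m ≤ n,
      (∀ᶠ R in atTop, dist (regularizeMap hs (bumpSeq d n) R u) u ≤ 1 / ((m : ℝ) + 1)) →
        dist (regularizeMap hs (bumpSeq d n) R u) u ≤ 1 / ((m : ℝ) + 1) := by
    intro n
    have h : ∀ᶠ R in atTop, ∀ m ∈ Finset.range (n + 1),
        (∀ᶠ R in atTop, dist (regularizeMap hs (bumpSeq d n) R u) u ≤ 1 / ((m : ℝ) + 1)) →
        dist (regularizeMap hs (bumpSeq d n) R u) u ≤ 1 / ((m : ℝ) + 1) := by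
      rw [Filter.eventually_all_finset]
      intro m _
      by_cases hm : ∀ᶠ R in atTop,
        dist (regularizeMap hs (bumpSeq d n) R u) u ≤ 1 / ((m : ℝ) + 1)
      · exact hm.mono fun R hR _ => hR
      · exact Eventually.of_forall fun R h => absurd h hm
    obtain ⟨R, hR, hn⟩ := (h.and (eventually_ge_atTop (n : ℝ))).exists
    exact ⟨R, hn, fun m hm => hR m (Finset.mem_range_succ_iff.mpr hm)⟩
  choose R hRn hR using hsel
  refine ⟨R, tendsto_atTop_mono hRn tendsto_natCast_atTop_atTop, ?_⟩
  rw [Metric.tendsto_nhds]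
  intro ε hε
  obtain ⟨m, hm⟩ := exists_nat_one_div_lt hε
  filter_upwards [exists_dist_regularizeMap_le hs u (ε := 1 / ((m : ℝ) + 1)) (by positivity),
    eventually_ge_atTop m] with n hn hmn
  exact (hR n m hmn hn).trans_lt hm

end Approximation

/-! ### Continuous processes and Brownian motion -/

section Processes

variable {Ω : Type*} [MeasurableSpace Ω] {P : Measure Ω}

/-- Two processes with continuous paths that are modifications of each other are
indistinguishable. -/
theorem ae_forall_mem_Icc_eq {F : Type*} [TopologicalSpace F] [T2Space F] {T : ℝ}
    {X Y : ℝ → Ω → F}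
    (hX : ∀ᵐ ω ∂P, ContinuousOn (fun t => X t ω) (Icc 0 T))
    (hY : ∀ᵐ ω ∂P, ContinuousOn (fun t => Y t ω) (Icc 0 T))
    (h : ∀ t ∈ Icc 0 T, ∀ᵐ ω ∂P, X t ω = Y t ω) :
    ∀ᵐ ω ∂P, ∀ t ∈ Icc 0 T, X t ω = Y t ω := by
  obtain ⟨D, hDc, hD⟩ := TopologicalSpace.exists_countable_dense (Icc (0 : ℝ) T)
  have hall : ∀ᵐ ω ∂P, ∀ t ∈ D, X t ω = Y t ω :=
    (ae_ball_iff hDc).mpr fun t _ => h t t.2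
  filter_upwards [hX, hY, hall] with ω h1 h2 h3 t ht
  have := Continuous.ext_on hD h1.domRestrict h2.domRestrict (fun t ht => h3 t ht)
  exact congrFun this ⟨t, ht⟩

theorem TendstoUCP.tendstoInMeasure {ι F : Type*} [PseudoMetricSpace F] {T : ℝ}
    {X : ι → ℝ → Ω → F} {a : Filter ι} {Y : ℝ → Ω → F} (h : TendstoUCP P T X a Y) {t : ℝ}
    (ht : t ∈ Icc 0 T) : TendstoInMeasure P (fun n => X n t) a (Y t) := by
  rw [tendstoInMeasure_iff_dist]
  intro η hη
  exact tendsto_of_tendsto_of_tendsto_of_le_of_le tendsto_const_nhds (h η hη)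
    (fun _ => zero_le) (fun n => measure_mono fun ω hω => ⟨t, ht, hω⟩)

theorem absolutelyContinuous_pi : ∀ {n : ℕ} {μ ν : Fin n → Measure ℝ} [∀ i, SigmaFinite (μ i)]
    [∀ i, SigmaFinite (ν i)], (∀ i, μ i ≪ ν i) → Measure.pi μ ≪ Measure.pi ν
  | 0, μ, ν, _, _, _ => by
    rw [Measure.pi_of_empty, Measure.pi_of_empty]
  | n + 1, μ, ν, _, _, h => by
    have hμ := measurePreserving_piFinSuccAbove μ 0
    have hν := measurePreserving_piFinSuccAbove ν 0
    have hp := (h 0).prod (absolutelyContinuous_pi fun j => h (Fin.succAbove 0 j))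
    rw [← hμ.symm.map_eq, ← hν.symm.map_eq]
    exact hp.map (MeasurableEquiv.measurable _)

/-- The law is a product of Gaussians of variance `q`, nondegenerate because `q ≠ 0`. -/
theorem IsBrownianVec.map_absolutelyContinuous [IsProbabilityMeasure P] {d : ℕ}
    {W : ℝ≥0 → Ω → Rd d} (hW : IsBrownianVec W P) {q : ℝ≥0} (hq : q ≠ 0) :
    P.map (W q) ≪ volume := by
  have hind : iIndepFun (fun (i : Fin d) ω => W q ω i) P :=
    hW.independent.comp (fun _ p => p q) fun _ => measurable_pi_apply q
  have hm : ∀ i, Measurable fun ω => W q ω i := fun i => by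
    have := hW.measurable q
    fun_prop
  have hpi := hind.map_fun_eq_pi_map fun i => (hm i).aemeasurable
  have hlaw : ∀ i, P.map (fun ω => W q ω i) = gaussianReal 0 q := fun i =>
    ((hW.isBrownianReal i).hasLaw_eval q).map_eq
  simp only [hlaw] at hpi
  have hac : P.map (fun ω i => W q ω i) ≪ volume := by
    rw [hpi]
    exact absolutelyContinuous_pi fun i => gaussianReal_absolutelyContinuous 0 hq
  have hmp := PiLp.volume_preserving_toLp (Fin d)
  have e : P.map (W q) = (P.map (fun ω i => W q ω i)).map
      (WithLp.toLp 2) := by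
    rw [Measure.map_map (by fun_prop) (measurable_pi_lambda _ hm)]
    rfl
  rw [e, ← hmp.map_eq]
  exact hac.map (by fun_prop)

/-- A Brownian motion coincides almost surely with a Brownian motion all of whose paths are
continuous. -/
theorem IsBrownianVec.exists_continuous_modification {d : ℕ} {W : ℝ≥0 → Ω → Rd d}
    (hW : IsBrownianVec W P) :
    ∃ V : ℝ≥0 → Ω → Rd d, IsBrownianVec V P ∧ (∀ ω, Continuous fun t => V t ω) ∧
      ∀ᵐ ω ∂P, ∀ t, W t ω = V t ω := by
  have hc : ∀ᵐ ω ∂P, Continuous fun t => W t ω := by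
    filter_upwards [ae_all_iff.mpr fun i => (hW.isBrownianReal i).cont] with ω hω
    exact (PiLp.continuous_toLp 2 _).comp (continuous_pi hω)
  -- The set of discontinuous paths need not be measurable. It is enlarged to a measurable null set,
  -- on which `V` is put equal to `0`.
  obtain ⟨S, hS, hSm, hSP⟩ := exists_measurable_superset_of_null (ae_iff.mp hc)
  classical
  set V : ℝ≥0 → Ω → Rd d := fun t => S.piecewise (fun _ => 0) (W t) with hV
  have hVW : ∀ᵐ ω ∂P, ∀ t, W t ω = V t ω := by
    filter_upwards [measure_eq_zero_iff_ae_notMem.mp hSP] with ω hω t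
    simp [hV, hω]
  refine ⟨V, ⟨fun t => Measurable.piecewise hSm measurable_const (hW.measurable t), fun i => ?_, ?_⟩,
    fun ω => ?_, hVW⟩
  · refine ⟨(hW.isBrownianReal i).toIsPreBrownianReal.congr fun t => ?_, ?_⟩
    · filter_upwards [hVW] with ω hω
      rw [hω t]
    · filter_upwards [hVW, (hW.isBrownianReal i).cont] with ω hω h
      simpa only [hω] using h
  · refine hW.independent.congr fun i => ?_
    filter_upwards [hVW] with ω hω
    funext t
    rw [hω t]
  · by_cases hω : ω ∈ S
    · simpa [hV, hω] using continuous_const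
    · have : Continuous fun t => W t ω := by
        by_contra h
        exact hω (hS h)
      simpa [hV, hω] using this

end Processes

/-! ### The covariation of Brownian motion -/

section Covariation

/-- The product of the increments of `X` and `Y` over `[s, s + ε]`, centered by `c ε`. -/
noncomputable def centeredIncrementProd {Ω : Type*} (X Y : ℝ≥0 → Ω → ℝ) (c ε s : ℝ) (ω : Ω) : ℝ :=
  (X (s + ε).toNNReal ω - X s.toNNReal ω) * (Y (s + ε).toNNReal ω - Y s.toNNReal ω) - c * ε

theorem centeredIncrementProd_eq {Ω : Type*} {X Y : ℝ≥0 → Ω → ℝ} {c ε s : ℝ} (hε : 0 < ε) (hs : 0 ≤ s)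
    (ω : Ω) :
    centeredIncrementProd X Y c ε s ω =
      (X (s.toNNReal + ε.toNNReal) ω - X s.toNNReal ω) *
        (Y (s.toNNReal + ε.toNNReal) ω - Y s.toNNReal ω) - c * ε := by
  rw [centeredIncrementProd, Real.toNNReal_add hs hε.le]

variable {Ω : Type*} [MeasurableSpace Ω] {P : Measure Ω} [IsProbabilityMeasure P]

theorem abs_mul_le_add_sq (a b : ℝ) : |a * b| ≤ a ^ 2 + b ^ 2 := by
  rw [abs_mul]
  nlinarith [sq_nonneg (|a| - |b|), sq_abs a, sq_abs b, sq_nonneg a, sq_nonneg b]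

/-- Second moment of the time integral of a process whose correlations have range `ε`. -/
theorem integral_sq_intervalIntegral_le {Z : ℝ → Ω → ℝ} (hZ : Measurable (Function.uncurry Z))
    {t ε K : ℝ} (ht : 0 ≤ t) (hε : 0 ≤ ε)
    (hi : ∀ s, 0 ≤ s → Integrable (fun ω => Z s ω ^ 2) P)
    (hK : ∀ s, 0 ≤ s → ∫ ω, Z s ω ^ 2 ∂P ≤ K)
    (h0 : ∀ s s', 0 ≤ s → 0 ≤ s' → ε ≤ |s - s'| → ∫ ω, Z s ω * Z s' ω ∂P = 0) :
    Integrable (fun ω => (∫ s in (0 : ℝ)..t, Z s ω) ^ 2) P ∧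
      ∫ ω, (∫ s in (0 : ℝ)..t, Z s ω) ^ 2 ∂P ≤ 2 * K * (2 * ε) * t := by
  have hK0 : 0 ≤ K := le_trans (integral_nonneg fun ω => sq_nonneg _) (hK 0 le_rfl)
  set m : Measure ℝ := volume.restrict (Ioc 0 t) with hm
  have hZs : ∀ s, Measurable (Z s) := fun s => hZ.comp measurable_prodMk_left
  have hmem : ∀ᵐ p ∂(m.prod m), 0 ≤ p.1 ∧ 0 ≤ p.2 := by
    rw [hm, Measure.prod_restrict]
    filter_upwards [ae_restrict_mem (measurableSet_Ioc.prod measurableSet_Ioc)] with p hp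
    exact ⟨hp.1.1.le, hp.2.1.le⟩
  have hprod : ∀ s s', 0 ≤ s → 0 ≤ s' → Integrable (fun ω => Z s ω * Z s' ω) P := by
    intro s s' hs hs'
    refine ((hi s hs).add (hi s' hs')).mono' ((hZs s).mul (hZs s')).aestronglyMeasurable
      (ae_of_all _ fun ω => ?_)
    exact abs_mul_le_add_sq _ _
  have hbound : ∀ s s', 0 ≤ s → 0 ≤ s' → ∫ ω, ‖Z s ω * Z s' ω‖ ∂P ≤ 2 * K := by
    intro s s' hs hs'
    calc ∫ ω, ‖Z s ω * Z s' ω‖ ∂P ≤ ∫ ω, (Z s ω ^ 2 + Z s' ω ^ 2) ∂P :=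
          integral_mono (hprod s s' hs hs').norm ((hi s hs).add (hi s' hs'))
            fun ω => abs_mul_le_add_sq _ _
      _ = ∫ ω, Z s ω ^ 2 ∂P + ∫ ω, Z s' ω ^ 2 ∂P := integral_add (hi s hs) (hi s' hs')
      _ ≤ 2 * K := by linarith [hK s hs, hK s' hs']
  have hFm : Measurable fun p : (ℝ × ℝ) × Ω => Z p.1.1 p.2 * Z p.1.2 p.2 :=
    (hZ.comp ((measurable_fst.comp measurable_fst).prodMk measurable_snd)).mul
      (hZ.comp ((measurable_snd.comp measurable_fst).prodMk measurable_snd))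
  have hF : Integrable (fun p : (ℝ × ℝ) × Ω => Z p.1.1 p.2 * Z p.1.2 p.2) ((m.prod m).prod P) := by
    rw [integrable_prod_iff hFm.aestronglyMeasurable]
    refine ⟨hmem.mono fun p hp => hprod _ _ hp.1 hp.2, ?_⟩
    refine Integrable.of_bound hFm.norm.stronglyMeasurable.integral_prod_right.aestronglyMeasurable
      (2 * K) (hmem.mono fun p hp => ?_)
    rw [Real.norm_of_nonneg (integral_nonneg fun ω => norm_nonneg _)]
    exact hbound _ _ hp.1 hp.2
  have hsq : ∀ ω, (∫ s in (0 : ℝ)..t, Z s ω) ^ 2 =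
      ∫ p, Z p.1 ω * Z p.2 ω ∂(m.prod m) := by
    intro ω
    rw [intervalIntegral.integral_of_le ht, sq,
      integral_prod_mul (fun s => Z s ω) (fun s => Z s ω)]
  -- Only the strip `|s - s'| < ε` contributes. The constant `2 * K` comes from `|ab| ≤ a² + b²`.
  have hcorr : ∀ᵐ p ∂(m.prod m), ∫ ω, Z p.1 ω * Z p.2 ω ∂P ≤
      {p : ℝ × ℝ | |p.1 - p.2| < ε}.indicator (fun _ => 2 * K) p := by
    filter_upwards [hmem] with p hp
    by_cases h : |p.1 - p.2| < ε
    · rw [indicator_of_mem (by exact h)]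
      exact (Real.le_norm_self _).trans
        ((norm_integral_le_integral_norm _).trans (hbound _ _ hp.1 hp.2))
    · rw [indicator_of_notMem (by exact h), h0 _ _ hp.1 hp.2 (not_lt.mp h)]
  have hset : MeasurableSet {p : ℝ × ℝ | |p.1 - p.2| < ε} :=
    measurableSet_lt (by fun_prop) measurable_const
  have hind : Integrable ({p : ℝ × ℝ | |p.1 - p.2| < ε}.indicator fun _ => 2 * K) (m.prod m) :=
    (integrable_const (2 * K)).indicator hset
  simp only [hsq]
  refine ⟨hF.integral_prod_right, ?_⟩
  calc ∫ ω, (∫ p, Z p.1 ω * Z p.2 ω ∂(m.prod m)) ∂P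
      = ∫ p, (∫ ω, Z p.1 ω * Z p.2 ω ∂P) ∂(m.prod m) := (integral_integral_swap hF).symm
    _ ≤ ∫ p, {p : ℝ × ℝ | |p.1 - p.2| < ε}.indicator (fun _ => 2 * K) p ∂(m.prod m) :=
        integral_mono_ae hF.integral_prod_left hind hcorr
    _ = ∫ s, (∫ s', {p : ℝ × ℝ | |p.1 - p.2| < ε}.indicator (fun _ => 2 * K) (s, s') ∂m) ∂m :=
        integral_prod _ hind
    _ ≤ ∫ s, 2 * K * (2 * ε) ∂m := by
        refine integral_mono_of_nonneg (ae_of_all _ fun s => integral_nonneg fun s' =>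
          indicator_nonneg (fun _ _ => by positivity) _) (integrable_const _)
          (ae_of_all _ fun s => ?_)
        have e : (fun s' => {p : ℝ × ℝ | |p.1 - p.2| < ε}.indicator (fun _ => 2 * K) (s, s')) =
            (Ioo (s - ε) (s + ε)).indicator fun _ => 2 * K := by
          funext s'
          simp only [indicator, mem_ofPred_eq, mem_Ioo, abs_lt]
          congr 1
          exact propext ⟨fun h => ⟨by linarith, by linarith⟩, fun h => ⟨by linarith, by linarith⟩⟩
        simp only [e]
        rw [integral_indicator measurableSet_Ioo, setIntegral_const, smul_eq_mul, mul_comm]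
        refine mul_le_mul_of_nonneg_left ?_ (by positivity)
        calc m.real (Ioo (s - ε) (s + ε)) ≤ volume.real (Ioo (s - ε) (s + ε)) :=
              ENNReal.toReal_mono (by simp) (Measure.restrict_apply_le _ _)
          _ = 2 * ε := by rw [Real.volume_real_Ioo_of_le (by linarith)]; ring
    _ = 2 * K * (2 * ε) * t := by
        rw [integral_const, smul_eq_mul, hm, measureReal_restrict_apply_univ,
          Real.volume_real_Ioc_of_le ht]
        ring

/-- Chebyshev's inequality. The integral of the centered products has second moment at most `4 K t
ε³`: a factor `K ε²` from each pair of times, and a strip of width `2ε` where they correlate.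
Division by `(η ε)²` leaves a bound of order `ε`. -/
theorem tendstoInMeasure_covariation {X Y : ℝ≥0 → Ω → ℝ} (hXm : ∀ t, Measurable (X t))
    (hYm : ∀ t, Measurable (Y t)) (hX : ∀ ω, Continuous fun t => X t ω)
    (hY : ∀ ω, Continuous fun t => Y t ω) {c K : ℝ}
    (hi : ∀ ε s, 0 < ε → 0 ≤ s → Integrable (fun ω => centeredIncrementProd X Y c ε s ω ^ 2) P)
    (hK : ∀ ε s, 0 < ε → 0 ≤ s → ∫ ω, centeredIncrementProd X Y c ε s ω ^ 2 ∂P ≤ K * ε ^ 2)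
    (h0 : ∀ ε s s', 0 < ε → 0 ≤ s → 0 ≤ s' → ε ≤ |s - s'| →
      ∫ ω, centeredIncrementProd X Y c ε s ω * centeredIncrementProd X Y c ε s' ω ∂P = 0)
    {t : ℝ} (ht : 0 ≤ t) :
    TendstoInMeasure P (fun (ε : ℝ) ω => ε⁻¹ * ∫ s in (0 : ℝ)..t,
      (X (s + ε).toNNReal ω - X s.toNNReal ω) * (Y (s + ε).toNNReal ω - Y s.toNNReal ω))
      (𝓝[>] 0) (fun _ => c * t) := by
  rw [tendstoInMeasure_iff_measureReal_dist]
  intro η hη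
  have hlim : Tendsto (fun ε : ℝ => 4 * K * t / η ^ 2 * ε) (𝓝[>] 0) (𝓝 0) := by
    have : Tendsto (fun ε : ℝ => 4 * K * t / η ^ 2 * ε) (𝓝 0) (𝓝 (4 * K * t / η ^ 2 * 0)) :=
      tendsto_id.const_mul _
    rw [mul_zero] at this
    exact this.mono_left nhdsWithin_le_nhds
  refine tendsto_of_tendsto_of_tendsto_of_le_of_le' tendsto_const_nhds hlim
    (Eventually.of_forall fun _ => measureReal_nonneg) ?_
  filter_upwards [self_mem_nhdsWithin] with ε hε
  have hε : 0 < ε := hε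
  have hcont : ∀ ω, Continuous fun s : ℝ => (X (s + ε).toNNReal ω - X s.toNNReal ω) *
      (Y (s + ε).toNNReal ω - Y s.toNNReal ω) := fun ω => by
    have h1 := hX ω
    have h2 := hY ω
    have h3 : Continuous fun s : ℝ => (s + ε).toNNReal :=
      continuous_real_toNNReal.comp (continuous_id.add continuous_const)
    exact ((h1.comp h3).sub (h1.comp continuous_real_toNNReal)).mul
      ((h2.comp h3).sub (h2.comp continuous_real_toNNReal))
  have hZm : Measurable (Function.uncurry (centeredIncrementProd X Y c ε)) := by
    refine measurable_uncurry_of_continuous_of_measurable (fun ω => ?_) fun s => ?_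
    · exact (hcont ω).sub continuous_const
    · exact (((hXm _).sub (hXm _)).mul ((hYm _).sub (hYm _))).sub_const _
  obtain ⟨h1, h2⟩ := integral_sq_intervalIntegral_le (P := P) hZm ht hε.le (hi ε · hε) (hK ε · hε)
    (h0 ε · · hε)
  have hset : {ω | η ≤ dist (ε⁻¹ * ∫ s in (0 : ℝ)..t,
      (X (s + ε).toNNReal ω - X s.toNNReal ω) * (Y (s + ε).toNNReal ω - Y s.toNNReal ω)) (c * t)} ⊆
      {ω | (η * ε) ^ 2 ≤ (∫ s in (0 : ℝ)..t, centeredIncrementProd X Y c ε s ω) ^ 2} := by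
    intro ω hω
    have e : ∫ s in (0 : ℝ)..t, centeredIncrementProd X Y c ε s ω =
        ε * (ε⁻¹ * (∫ s in (0 : ℝ)..t, (X (s + ε).toNNReal ω - X s.toNNReal ω) *
          (Y (s + ε).toNNReal ω - Y s.toNNReal ω)) - c * t) := by
      simp only [centeredIncrementProd]
      rw [intervalIntegral.integral_sub ((hcont ω).intervalIntegrable _ _)
        intervalIntegrable_const, intervalIntegral.integral_const]
      rw [mul_sub, mul_inv_cancel_left₀ hε.ne']
      simp; ring
    simp only [mem_ofPred_eq, Real.dist_eq] at hω ⊢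
    rw [e, mul_pow, mul_pow, mul_comm, ← sq_abs (_ - _)]
    gcongr
  have hmarkov := mul_meas_ge_le_integral_of_nonneg (μ := P)
    (ae_of_all _ fun ω => sq_nonneg (∫ s in (0 : ℝ)..t, centeredIncrementProd X Y c ε s ω)) h1
    ((η * ε) ^ 2)
  have hmono := measureReal_mono (μ := P) hset
  have hpos : 0 < (η * ε) ^ 2 := by positivity
  refine hmono.trans ?_
  have : P.real {ω | (η * ε) ^ 2 ≤ (∫ s in (0 : ℝ)..t, centeredIncrementProd X Y c ε s ω) ^ 2} ≤
      (2 * (K * ε ^ 2) * (2 * ε) * t) / (η * ε) ^ 2 := by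
    rw [le_div_iff₀ hpos, mul_comm]
    exact hmarkov.trans h2
  refine this.trans (le_of_eq ?_)
  field_simp
  ring

end Covariation

/-! ### Moments and independence of Brownian increments, and the value of the covariation. -/

section BrownianCovariation

variable {Ω : Type*} [MeasurableSpace Ω] {P : Measure Ω}

theorem ProbabilityTheory.IsPreBrownianReal.hasLaw_increment {X : ℝ≥0 → Ω → ℝ} (hX : IsPreBrownianReal X P)
    (a e : ℝ≥0) : HasLaw (fun ω => X (a + e) ω - X a ω) (gaussianReal 0 e) P := by
  have h := hX.hasLaw_sub (a + e) a
  have : nndist ((a + e : ℝ≥0) : ℝ) (a : ℝ) = e := by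
    rw [← NNReal.coe_inj, coe_nndist, Real.dist_eq]
    simp
  rw [show nndist ((a + e : ℝ≥0) : ℝ≥0).1 a.1 = e from this] at h
  exact h

theorem ProbabilityTheory.IsPreBrownianReal.memLp_increment {X : ℝ≥0 → Ω → ℝ} (hX : IsPreBrownianReal X P)
    (a e : ℝ≥0) (p : ℝ≥0) : MemLp (fun ω => X (a + e) ω - X a ω) p P := by
  have h := hX.hasLaw_increment a e
  have := memLp_id_gaussianReal (μ := 0) (v := e) p
  rw [← h.map_eq] at this
  exact (memLp_map_measure_iff aestronglyMeasurable_id h.aemeasurable).mp this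

theorem ProbabilityTheory.IsPreBrownianReal.integral_increment {X : ℝ≥0 → Ω → ℝ} (hX : IsPreBrownianReal X P)
    (a e : ℝ≥0) : ∫ ω, (X (a + e) ω - X a ω) ∂P = 0 := by
  have h := (hX.hasLaw_increment a e).integral_eq
  rw [h, integral_id_gaussianReal]

theorem ProbabilityTheory.IsPreBrownianReal.integral_increment_sq {X : ℝ≥0 → Ω → ℝ} (hX : IsPreBrownianReal X P)
    (a e : ℝ≥0) : ∫ ω, (X (a + e) ω - X a ω) ^ 2 ∂P = e := by
  have h := hX.hasLaw_increment a e
  have hv := h.variance_eq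
  rw [variance_of_integral_eq_zero h.aemeasurable (hX.integral_increment a e)] at hv
  rw [hv, variance_id_gaussianReal]

/-- Gaussian scaling by `√e`. Only the factor `e²` matters later, so the fourth moment of the
standard law is left unevaluated. -/
theorem integral_pow_four_gaussianReal (e : ℝ≥0) :
    ∫ x, x ^ 4 ∂(gaussianReal 0 e) = (∫ x, x ^ 4 ∂(gaussianReal 0 1)) * (e : ℝ) ^ 2 := by
  have h := gaussianReal_map_const_mul (μ := 0) (v := 1) (√(e : ℝ))
  have he : NNReal.mk (√(e : ℝ) ^ 2) (sq_nonneg _) * 1 = e := by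
    rw [mul_one]; ext; exact Real.sq_sqrt e.2
  rw [mul_zero, he] at h
  rw [← h, integral_map (by fun_prop) (by fun_prop), mul_comm, ← integral_const_mul]
  congr 1; funext x
  rw [mul_pow, show √(e : ℝ) ^ 4 = (√(e : ℝ) ^ 2) ^ 2 by ring,
    Real.sq_sqrt e.coe_nonneg]

theorem ProbabilityTheory.IsPreBrownianReal.integral_increment_pow_four {X : ℝ≥0 → Ω → ℝ}
    (hX : IsPreBrownianReal X P) (a e : ℝ≥0) :
    ∫ ω, (X (a + e) ω - X a ω) ^ 4 ∂P = (∫ x, x ^ 4 ∂(gaussianReal 0 1)) * (e : ℝ) ^ 2 := by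
  have h := hX.hasLaw_increment a e
  rw [← integral_pow_four_gaussianReal, ← h.map_eq, integral_map h.aemeasurable (by fun_prop)]

theorem ProbabilityTheory.IsPreBrownianReal.indepFun_increment {X : ℝ≥0 → Ω → ℝ} (hX : IsPreBrownianReal X P)
    {a e a' : ℝ≥0} (h : a + e ≤ a') :
    IndepFun (fun ω => X (a + e) ω - X a ω) (fun ω => X (a' + e) ω - X a' ω) P := by
  -- Increments `0` and `2` along the partition `a ≤ a + e ≤ a' ≤ a' + e`; the middle one is
  -- discarded.
  have hmono : Monotone (![a, a + e, a', a' + e] : Fin 4 → ℝ≥0) := by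
    rw [Fin.monotone_iff_le_succ]
    intro i
    fin_cases i
    · exact le_add_of_nonneg_right zero_le
    · exact h
    · exact le_add_of_nonneg_right zero_le
  exact (hX.hasIndepIncrements 3 _ hmono).indepFun (i := 0) (j := 2) (by decide)

theorem toNNReal_add_le_or {ε s s' : ℝ} (hε : 0 < ε) (hs : 0 ≤ s) (hs' : 0 ≤ s')
    (h : ε ≤ |s - s'|) :
    s.toNNReal + ε.toNNReal ≤ s'.toNNReal ∨ s'.toNNReal + ε.toNNReal ≤ s.toNNReal := by
  rw [← Real.toNNReal_add hs hε.le, ← Real.toNNReal_add hs' hε.le]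
  rcases le_abs.mp h with h | h
  · exact Or.inr (Real.toNNReal_le_toNNReal (by linarith))
  · exact Or.inl (Real.toNNReal_le_toNNReal (by linarith))

variable [IsProbabilityMeasure P]

theorem ProbabilityTheory.IsPreBrownianReal.tendstoInMeasure_self {X : ℝ≥0 → Ω → ℝ} (hX : IsPreBrownianReal X P)
    (hXm : ∀ t, Measurable (X t)) (hXc : ∀ ω, Continuous fun t => X t ω) {t : ℝ} (ht : 0 ≤ t) :
    TendstoInMeasure P (fun (ε : ℝ) ω => ε⁻¹ * ∫ s in (0 : ℝ)..t,
      (X (s + ε).toNNReal ω - X s.toNNReal ω) * (X (s + ε).toNNReal ω - X s.toNNReal ω))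
      (𝓝[>] 0) (fun _ => 1 * t) := by
  set M := ∫ x, x ^ 4 ∂(gaussianReal 0 1)
  have h4 : ∀ a e, Integrable (fun ω => (X (a + e) ω - X a ω) ^ 4) P := fun a e => by
    have := (hX.memLp_increment a e 4).integrable_norm_pow (by norm_num)
    refine this.congr (ae_of_all _ fun ω => ?_)
    simp only [Real.norm_eq_abs]
    rw [← abs_pow, abs_of_nonneg (by positivity)]
  have h2 : ∀ a e, Integrable (fun ω => (X (a + e) ω - X a ω) ^ 2) P := fun a e =>
    (hX.memLp_increment a e 2).integrable_sq
  -- From `(x² - ε)² + (x² + ε)² = 2x⁴ + 2ε²`.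
  have hsq : ∀ ε s, 0 < ε → 0 ≤ s → ∀ ω, centeredIncrementProd X X 1 ε s ω ^ 2 ≤
      2 * (X (s.toNNReal + ε.toNNReal) ω - X s.toNNReal ω) ^ 4 + 2 * ε ^ 2 := by
    intro ε s hε hs ω
    rw [centeredIncrementProd_eq hε hs]
    nlinarith [sq_nonneg ((X (s.toNNReal + ε.toNNReal) ω - X s.toNNReal ω) ^ 2 + ε)]
  have hdom : ∀ ε s, Integrable (fun ω =>
      2 * (X (s + ε) ω - X s ω) ^ 4 + 2 * (ε : ℝ) ^ 2) P := fun ε s =>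
    ((h4 s ε).const_mul 2).add (integrable_const _)
  have hi : ∀ ε s, 0 < ε → 0 ≤ s →
      Integrable (fun ω => centeredIncrementProd X X 1 ε s ω ^ 2) P := by
    intro ε s hε hs
    refine (hdom ε.toNNReal s.toNNReal).mono' ?_ (ae_of_all _ fun ω => ?_)
    · have := hXm
      unfold centeredIncrementProd
      exact ((((hXm _).sub (hXm _)).mul ((hXm _).sub (hXm _))).sub_const _).pow_const 2
        |>.aestronglyMeasurable
    · rw [Real.norm_of_nonneg (sq_nonneg _), Real.coe_toNNReal ε hε.le]
      exact hsq ε s hε hs ω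
  refine tendstoInMeasure_covariation hXm hXm hXc hXc (K := 2 * M + 2) hi ?_ ?_ ht
  · intro ε s hε hs
    calc ∫ ω, centeredIncrementProd X X 1 ε s ω ^ 2 ∂P
        ≤ ∫ ω, (2 * (X (s.toNNReal + ε.toNNReal) ω - X s.toNNReal ω) ^ 4 +
            2 * (ε.toNNReal : ℝ) ^ 2) ∂P :=
          integral_mono (hi ε s hε hs) (hdom ε.toNNReal s.toNNReal) fun ω => by
            simp only [Real.coe_toNNReal ε hε.le]
            exact hsq ε s hε hs ω
      _ = (2 * M + 2) * ε ^ 2 := by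
          rw [integral_add ((h4 _ _).const_mul 2) (integrable_const _), integral_const_mul,
            hX.integral_increment_pow_four, Real.coe_toNNReal ε hε.le]
          simp; ring
  · intro ε s s' hε hs hs' h
    simp only [centeredIncrementProd_eq hε hs, centeredIncrementProd_eq hε hs', ← sq]
    have hind : IndepFun (fun ω => X (s.toNNReal + ε.toNNReal) ω - X s.toNNReal ω)
        (fun ω => X (s'.toNNReal + ε.toNNReal) ω - X s'.toNNReal ω) P := by
      rcases toNNReal_add_le_or hε hs hs' h with h | h
      · exact hX.indepFun_increment h
      · exact (hX.indepFun_increment h).symm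
    have hind' := hind.comp (φ := fun x => x ^ 2 - 1 * ε) (ψ := fun x => x ^ 2 - 1 * ε)
      (by fun_prop) (by fun_prop)
    have hz : ∀ a : ℝ≥0, ∫ ω, ((X (a + ε.toNNReal) ω - X a ω) ^ 2 - 1 * ε) ∂P = 0 := fun a => by
      rw [integral_sub (h2 _ _) (integrable_const _), hX.integral_increment_sq,
        Real.coe_toNNReal ε hε.le]
      simp
    have := hind'.integral_fun_mul_eq_mul_integral
      (((h2 _ _).sub (integrable_const _)).aestronglyMeasurable)
      (((h2 _ _).sub (integrable_const _)).aestronglyMeasurable)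
    simp only [Function.comp_apply] at this
    rw [this, hz, zero_mul]

/-- Independence of `X` and `Y` gives the products second moment exactly `ε²`, hence `K = 1`. At
time lag at least `ε` the correlation has the factor `E[ΔX ΔX'] = 0`. -/
theorem ProbabilityTheory.IsPreBrownianReal.tendstoInMeasure_of_indepFun {X Y : ℝ≥0 → Ω → ℝ}
    (hX : IsPreBrownianReal X P) (hY : IsPreBrownianReal Y P)
    (hXm : ∀ t, Measurable (X t)) (hYm : ∀ t, Measurable (Y t))
    (hXc : ∀ ω, Continuous fun t => X t ω) (hYc : ∀ ω, Continuous fun t => Y t ω)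
    (hXY : IndepFun (fun ω t => X t ω) (fun ω t => Y t ω) P) {t : ℝ} (ht : 0 ≤ t) :
    TendstoInMeasure P (fun (ε : ℝ) ω => ε⁻¹ * ∫ s in (0 : ℝ)..t,
      (X (s + ε).toNNReal ω - X s.toNNReal ω) * (Y (s + ε).toNNReal ω - Y s.toNNReal ω))
      (𝓝[>] 0) (fun _ => 0 * t) := by
  have hsqind : ∀ a e, IndepFun (fun ω => (X (a + e) ω - X a ω) ^ 2)
      (fun ω => (Y (a + e) ω - Y a ω) ^ 2) P := fun a e =>
    hXY.comp (φ := fun p : ℝ≥0 → ℝ => (p (a + e) - p a) ^ 2)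
      (ψ := fun p : ℝ≥0 → ℝ => (p (a + e) - p a) ^ 2) (by fun_prop) (by fun_prop)
  have h2X : ∀ a e, Integrable (fun ω => (X (a + e) ω - X a ω) ^ 2) P := fun a e =>
    (hX.memLp_increment a e 2).integrable_sq
  have h2Y : ∀ a e, Integrable (fun ω => (Y (a + e) ω - Y a ω) ^ 2) P := fun a e =>
    (hY.memLp_increment a e 2).integrable_sq
  have e2 : ∀ ε s, 0 < ε → 0 ≤ s → (fun ω => centeredIncrementProd X Y 0 ε s ω ^ 2) =
      fun ω => (X (s.toNNReal + ε.toNNReal) ω - X s.toNNReal ω) ^ 2 *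
        (Y (s.toNNReal + ε.toNNReal) ω - Y s.toNNReal ω) ^ 2 := by
    intro ε s hε hs
    funext ω
    rw [centeredIncrementProd_eq hε hs]; ring
  refine tendstoInMeasure_covariation hXm hYm hXc hYc (K := 1) ?_ ?_ ?_ ht
  · intro ε s hε hs
    rw [e2 ε s hε hs]
    exact (hsqind _ _).integrable_mul (h2X _ _) (h2Y _ _)
  · intro ε s hε hs
    simp only [e2 ε s hε hs]
    rw [(hsqind _ _).integral_fun_mul_eq_mul_integral (h2X _ _).aestronglyMeasurable
      (h2Y _ _).aestronglyMeasurable, hX.integral_increment_sq, hY.integral_increment_sq,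
      Real.coe_toNNReal ε hε.le]
    exact le_of_eq (by ring)
  · intro ε s s' hε hs hs' h
    simp only [centeredIncrementProd_eq hε hs, centeredIncrementProd_eq hε hs']
    set a := s.toNNReal
    set a' := s'.toNNReal
    set e := ε.toNNReal
    have hind : IndepFun (fun ω => (X (a + e) ω - X a ω) * (X (a' + e) ω - X a' ω))
        (fun ω => (Y (a + e) ω - Y a ω) * (Y (a' + e) ω - Y a' ω)) P :=
      hXY.comp (φ := fun p : ℝ≥0 → ℝ => (p (a + e) - p a) * (p (a' + e) - p a'))
        (ψ := fun p : ℝ≥0 → ℝ => (p (a + e) - p a) * (p (a' + e) - p a'))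
        (by fun_prop) (by fun_prop)
    have hXX : IndepFun (fun ω => X (a + e) ω - X a ω) (fun ω => X (a' + e) ω - X a' ω) P := by
      rcases toNNReal_add_le_or hε hs hs' h with h | h
      · exact hX.indepFun_increment h
      · exact (hX.indepFun_increment h).symm
    have hm : ∀ (Z : ℝ≥0 → Ω → ℝ), (∀ t, Measurable (Z t)) → ∀ b,
        AEStronglyMeasurable (fun ω => Z (b + e) ω - Z b ω) P := fun Z hZ b =>
      ((hZ _).sub (hZ _)).aestronglyMeasurable
    have key := hind.integral_fun_mul_eq_mul_integral ((hm X hXm a).mul (hm X hXm a'))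
      ((hm Y hYm a).mul (hm Y hYm a'))
    rw [hXX.integral_fun_mul_eq_mul_integral (hm X hXm a) (hm X hXm a'),
      hX.integral_increment, zero_mul, zero_mul] at key
    refine Eq.trans ?_ key
    congr 1; funext ω; ring

/-- The covariation matrix of a Brownian motion is `t` times the identity. -/
theorem IsBrownianVec.covariation_eq {d : ℕ} {W : ℝ≥0 → Ω → Rd d} (hW : IsBrownianVec W P) {T : ℝ}
    {i j : Fin d} (C : ContinuousProcess Ω T ℝ)
    (hC : IsCovariation P T (fun t ω => W t ω i) (fun t ω => W t ω j) C.val) :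
    ∀ᵐ ω ∂P, ∀ t ∈ Icc 0 T, C.val t ω = (if i = j then 1 else 0) * t := by
  refine ae_forall_mem_Icc_eq (ae_of_all _ C.continuousOn)
    (ae_of_all _ fun ω => by fun_prop) fun t ht => ?_
  -- Passing to paths that are all continuous makes the increments jointly measurable, as the second
  -- moment estimate requires. Limits in measure are unique, so `C` at time `t` must be the computed
  -- one.
  obtain ⟨V, hV, hVc, hWV⟩ := hW.exists_continuous_modification
  have hVm : ∀ (i : Fin d) t, Measurable fun ω => V t ω i := fun i t => by
    have := hV.measurable t
    fun_prop
  have hVc' : ∀ (i : Fin d) ω, Continuous fun t => V t ω i := fun i ω => by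
    have := hVc ω
    fun_prop
  have h1 : TendstoInMeasure P (fun (ε : ℝ) ω => ε⁻¹ * ∫ s in (0 : ℝ)..t,
      (V (s + ε).toNNReal ω i - V s.toNNReal ω i) * (V (s + ε).toNNReal ω j - V s.toNNReal ω j))
      (𝓝[>] 0) (C.val t) := by
    refine (hC.tendstoInMeasure ht).congr_left fun ε => ?_
    filter_upwards [hWV] with ω hω
    simp only [hω]
  have h2 : TendstoInMeasure P (fun (ε : ℝ) ω => ε⁻¹ * ∫ s in (0 : ℝ)..t,
      (V (s + ε).toNNReal ω i - V s.toNNReal ω i) * (V (s + ε).toNNReal ω j - V s.toNNReal ω j))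
      (𝓝[>] 0) (fun _ => (if i = j then 1 else 0) * t) := by
    split_ifs with hij
    · subst hij
      exact IsPreBrownianReal.tendstoInMeasure_self (hV.isBrownianReal i).toIsPreBrownianReal
        (hVm i) (hVc' i) ht.1
    · exact IsPreBrownianReal.tendstoInMeasure_of_indepFun
        (hV.isBrownianReal i).toIsPreBrownianReal (hV.isBrownianReal j).toIsPreBrownianReal
        (hVm i) (hVm j) (hVc' i) (hVc' j) (hV.independent.indepFun hij) ht.1
  exact tendstoInMeasure_ae_unique h1 h2

end BrownianCovariation

/-! ### The integral operator on continuous functions of compact support -/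

section StieltjesIntegral

theorem tendsto_riemannSum {f : ℝ → ℝ} {t : ℝ} (ht : 0 ≤ t) (hf : ContinuousOn f (Icc 0 t)) :
    Tendsto (fun n : ℕ => ∑ k ∈ Finset.range n, f (t * k / n) * (t * (k + 1) / n - t * k / n))
      atTop (𝓝 (∫ q in (0 : ℝ)..t, f q)) := by
  have huc := isCompact_Icc.uniformContinuousOn_of_continuous hf
  rw [Metric.uniformContinuousOn_iff] at huc
  rw [Metric.tendsto_atTop]
  intro ε hε
  -- The total error is at most `t * ε / (t + 1) < ε`; the `+ 1` also covers `t = 0`.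
  obtain ⟨δ, hδ, huc⟩ := huc (ε / (t + 1)) (by positivity)
  obtain ⟨N, hN⟩ := exists_nat_gt (t / δ)
  refine ⟨N + 1, fun n hn => ?_⟩
  have hn0 : (0 : ℝ) < n := by exact_mod_cast lt_of_lt_of_le N.succ_pos hn
  have hNn : (N : ℝ) ≤ n := by exact_mod_cast (Nat.le_succ N).trans hn
  have hstep : t / n < δ := by
    rw [div_lt_iff₀ hn0]
    have := (div_lt_iff₀ hδ).mp hN
    nlinarith
  set a : ℕ → ℝ := fun k => t * k / n with ha
  have hsucc : ∀ k : ℕ, a (k + 1) = t * (k + 1) / n := fun k => by simp [ha]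
  have hlen : ∀ k : ℕ, a (k + 1) - a k = t / n := fun k => by
    simp only [ha]; push_cast; ring
  have hle : ∀ k : ℕ, a k ≤ a (k + 1) := fun k => by
    have := hlen k
    have : 0 ≤ t / n := by positivity
    linarith
  have hmem : ∀ k < n, Icc (a k) (a (k + 1)) ⊆ Icc 0 t := fun k hk => by
    refine Icc_subset_Icc (by positivity) ?_
    rw [hsucc, div_le_iff₀ hn0]
    have : (k : ℝ) + 1 ≤ n := by exact_mod_cast hk
    nlinarith
  have h_int : ∀ k < n, IntervalIntegrable f volume (a k) (a (k + 1)) := fun k hk =>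
    (hf.mono (by rw [uIcc_of_le (hle k)]; exact hmem k hk)).intervalIntegrable
  have hsum := intervalIntegral.sum_integral_adjacent_intervals h_int
  have h0 : a 0 = 0 := by simp [ha]
  have h1 : a n = t := by simp only [ha]; field_simp
  rw [h0, h1] at hsum
  rw [← hsum, Real.dist_eq, ← Finset.sum_sub_distrib]
  have hterm : ∀ k ∈ Finset.range n,
      |f (t * k / n) * (t * (k + 1) / n - t * k / n) - ∫ q in a k..a (k + 1), f q| ≤
        ε / (t + 1) * (t / n) := by
    intro k hk
    have hk := Finset.mem_range.mp hk
    have e : f (t * k / n) * (t * (k + 1) / n - t * k / n) - ∫ q in a k..a (k + 1), f q =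
        ∫ q in a k..a (k + 1), (f (a k) - f q) := by
      rw [intervalIntegral.integral_sub intervalIntegrable_const (h_int k hk),
        intervalIntegral.integral_const, ← hsucc, smul_eq_mul, mul_comm]
    rw [e, ← Real.norm_eq_abs]
    refine (intervalIntegral.norm_integral_le_of_norm_le_const (C := ε / (t + 1))
      fun q hq => ?_).trans (le_of_eq ?_)
    · rw [uIoc_of_le (hle k)] at hq
      rw [← dist_eq_norm]
      refine (huc _ (hmem k hk (left_mem_Icc.mpr (hle k))) _ (hmem k hk ⟨hq.1.le, hq.2⟩) ?_).le
      rw [dist_comm, Real.dist_eq, abs_of_pos (by linarith [hq.1])]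
      linarith [hq.2, hlen k]
    · rw [hlen, abs_of_nonneg (by positivity)]
  refine (Finset.abs_sum_le_sum_abs _ _).trans_lt ((Finset.sum_le_sum hterm).trans_lt ?_)
  rw [Finset.sum_const, Finset.card_range, nsmul_eq_mul]
  have : (n : ℝ) * (ε / (t + 1) * (t / n)) = ε * (t / (t + 1)) := by field_simp
  rw [this]
  have : t / (t + 1) < 1 := by rw [div_lt_one (by positivity)]; linarith
  nlinarith

theorem isStieltjesIntegral_of_eqOn_linear {f c : ℝ → ℝ} {t m : ℝ} (ht : 0 ≤ t)
    (hf : ContinuousOn f (Icc 0 t)) (hc : ∀ q ∈ Icc 0 t, c q = m * q) :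
    IsStieltjesIntegral f c t (m * ∫ q in (0 : ℝ)..t, f q) := by
  refine ((tendsto_riemannSum ht hf).const_mul m).congr fun n => ?_
  rw [Finset.mul_sum]
  refine Finset.sum_congr rfl fun k hk => ?_
  have hk := Finset.mem_range.mp hk
  have hn0 : (0 : ℝ) < n := by exact_mod_cast (Nat.zero_le k).trans_lt hk
  have hk1 : (k : ℝ) + 1 ≤ n := by exact_mod_cast hk
  have h1 : t * k / n ∈ Icc 0 t :=
    ⟨by positivity, by rw [div_le_iff₀ hn0]; nlinarith⟩
  have h2 : t * (k + 1) / n ∈ Icc 0 t :=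
    ⟨by positivity, by rw [div_le_iff₀ hn0]; nlinarith⟩
  rw [hc _ h1, hc _ h2]; ring

theorem IsStieltjesIntegral.unique {f c : ℝ → ℝ} {t I J : ℝ} (hI : IsStieltjesIntegral f c t I)
    (hJ : IsStieltjesIntegral f c t J) : I = J := by
  unfold IsStieltjesIntegral at hI hJ
  exact tendsto_nhds_unique hI hJ

variable {Ω : Type*} [MeasurableSpace Ω] {P : Measure Ω}

theorem continuousOn_apply_path {d : ℕ} {T : ℝ} {l : ℝ → Rd d → Rd d}
    (hl : IsContinuousCompactSupport T l) {p : ℝ≥0 → Rd d} (hp : Continuous p) :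
    ContinuousOn (fun q : ℝ => l q (p q.toNNReal)) (Icc 0 T) :=
  hl.1.comp (continuousOn_id.prodMk (hp.comp continuous_real_toNNReal).continuousOn)
    fun _ hq => ⟨hq, mem_univ _⟩

theorem intervalIntegral_apply {d : ℕ} {f : ℝ → Rd d} {a b : ℝ}
    (hf : IntervalIntegrable f volume a b) (i : Fin d) :
    (∫ q in a..b, f q) i = ∫ q in a..b, f q i :=
  ((EuclideanSpace.proj (𝕜 := ℝ) i : Rd d →L[ℝ] ℝ).intervalIntegral_comp_comm hf).symm

/-- For `l` continuous of compact support, `A(l)` is the time integral of `l` along the path. -/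
theorem IsBrownianVec.integralAgainst_eq [IsProbabilityMeasure P] {d : ℕ} {W : ℝ≥0 → Ω → Rd d}
    (hW : IsBrownianVec W P) {T : ℝ} {C : Fin d → Fin d → ContinuousProcess Ω T ℝ}
    (hC : IsFVCovariationMatrix P T W W C) {l : ℝ → Rd d → Rd d}
    (hl : IsContinuousCompactSupport T l) {X : ContinuousProcess Ω T (Rd d)}
    (hX : IsIntegralAgainst P W C l X) :
    ∀ᵐ ω ∂P, ∀ t ∈ Icc 0 T, X.val t ω = ∫ q in (0 : ℝ)..t, l q (W q.toNNReal ω) := by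
  have hcov : ∀ᵐ ω ∂P, ∀ i j, ∀ t ∈ Icc 0 T, (C i j).val t ω = (if i = j then 1 else 0) * t :=
    ae_all_iff.mpr fun i => ae_all_iff.mpr fun j => hW.covariation_eq (C i j) (hC i j).1
  obtain ⟨V, -, hVc, hWV⟩ := hW.exists_continuous_modification
  filter_upwards [hcov, hX, hWV] with ω h1 h2 h3 t ht
  simp only [h3] at h2 ⊢
  have hcont := (continuousOn_apply_path hl (hVc ω)).mono (Icc_subset_Icc_right ht.2)
  have h_int : IntervalIntegrable (fun q : ℝ => l q (V q.toNNReal ω)) volume 0 t :=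
    (hcont.mono (by rw [uIcc_of_le ht.1])).intervalIntegrable
  have hcont' : ∀ i : Fin d, ContinuousOn (fun q : ℝ => l q (V q.toNNReal ω) i) (Icc 0 t) :=
    fun i => (PiLp.continuous_apply 2 (fun _ : Fin d => ℝ) i).comp_continuousOn hcont
  obtain ⟨I, hI, hIX⟩ := h2 t ht
  ext j
  rw [hIX j, intervalIntegral_apply h_int]
  -- Off the diagonal the integrator vanishes, so the sum over `i` reduces to `i = j`.
  have hI' : ∀ i, I i j = (if i = j then 1 else 0) *
      ∫ q in (0 : ℝ)..t, l q (V q.toNNReal ω) i := fun i =>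
    (hI i j).unique (isStieltjesIntegral_of_eqOn_linear ht.1 (hcont' i)
      fun q hq => h1 i j q ⟨hq.1, hq.2.trans ht.2⟩)
  simp [hI']

end StieltjesIntegral

/-! ### Evaluation along Brownian paths -/

section Paths

variable {Ω : Type*} [MeasurableSpace Ω] {P : Measure Ω} [IsProbabilityMeasure P] {d : ℕ}

/-- Null sets of `[0,T] × ℝ^d` are not seen by Brownian paths. -/
theorem IsBrownianVec.ae_ae_of_ae_volume {V : ℝ≥0 → Ω → Rd d} (hV : IsBrownianVec V P)
    (hVc : ∀ ω, Continuous fun t => V t ω) (T : ℝ) {p : ℝ → Rd d → Prop}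
    (hp : ∀ᵐ z ∂((volume : Measure (ℝ × Rd d)).restrict (Icc 0 T ×ˢ univ)), p z.1 z.2) :
    ∀ᵐ ω ∂P, ∀ᵐ q ∂((volume : Measure ℝ).restrict (Ioc 0 T)), p q (V q.toNNReal ω) := by
  have hVm : Measurable fun z : ℝ × Ω => (z.1, V z.1.toNNReal z.2) :=
    measurable_fst.prodMk (measurable_uncurry_of_continuous_of_measurable
      (u := fun (q : ℝ) ω => V q.toNNReal ω) (fun ω => (hVc ω).comp continuous_real_toNNReal)
      fun q => hV.measurable _)
  have hp' : ∀ᵐ z ∂(((volume : Measure ℝ).restrict (Ioc 0 T)).prod (volume : Measure (Rd d))),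
      p z.1 z.2 := by
    have e : ((volume : Measure ℝ).restrict (Ioc 0 T)).prod (volume : Measure (Rd d)) =
        (volume : Measure (ℝ × Rd d)).restrict (Ioc 0 T ×ˢ univ) := by
      rw [Measure.volume_eq_prod, ← Measure.prod_restrict, Measure.restrict_univ]
    rw [e]
    exact ae_restrict_of_ae_restrict_of_subset (prod_mono_left Ioc_subset_Icc_self) hp
  obtain ⟨N, hN, hNm, hN0⟩ := exists_measurable_superset_of_null (ae_iff.mp hp')
  have hsec := Measure.measure_ae_null_of_prod_null hN0
  have hae : ∀ᵐ q ∂((volume : Measure ℝ).restrict (Ioc 0 T)), ∀ᵐ ω ∂P,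
      (q, V q.toNNReal ω) ∉ N := by
    filter_upwards [hsec, ae_restrict_mem measurableSet_Ioc] with q hq hqT
    -- The half-open interval keeps `q > 0`; at `q = 0` the law is a point mass.
    have hac := hV.map_absolutelyContinuous (q := q.toNNReal)
      (by simpa using hqT.1)
    have h0 := hac hq
    rw [Measure.map_apply (hV.measurable _) (measurable_prodMk_left hNm)] at h0
    exact measure_eq_zero_iff_ae_notMem.mp h0
  have hmeas : MeasurableSet {z : ℝ × Ω | (z.1, V z.1.toNNReal z.2) ∉ N} := (hVm hNm).compl
  have := (Measure.ae_ae_comm (p := fun q ω => (q, V q.toNNReal ω) ∉ N) hmeas).mp hae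
  filter_upwards [this] with ω hω
  filter_upwards [hω] with q hq
  by_contra h
  exact hq (hN h)

end Paths

/-! ### Mollification of locally bounded functions: uniform bounds and almost everywhere
convergence. -/

section LocallyBounded

/-- Passing from slices to the product requires a measurable convergence set, hence the measurable
representatives. Working with norms of differences keeps the limit criterion real-valued. -/
theorem ae_prod_tendsto {α β E : Type*} [MeasurableSpace α] [MeasurableSpace β]
    [NormedAddCommGroup E] {μ : Measure α} {ν : Measure β} [SFinite μ] [SFinite ν]
    {f : ℕ → α × β → E} {g : α × β → E} (hf : ∀ n, AEStronglyMeasurable (f n) (μ.prod ν))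
    (hg : AEStronglyMeasurable g (μ.prod ν))
    (h : ∀ᵐ x ∂μ, ∀ᵐ y ∂ν, Tendsto (fun n => f n (x, y)) atTop (𝓝 (g (x, y)))) :
    ∀ᵐ z ∂(μ.prod ν), Tendsto (fun n => f n z) atTop (𝓝 (g z)) := by
  have hall : ∀ᵐ z ∂(μ.prod ν), (∀ n, f n z = (hf n).mk (f n) z) ∧ g z = hg.mk g z :=
    (ae_all_iff.mpr fun n => (hf n).ae_eq_mk).and hg.ae_eq_mk
  have hm : MeasurableSet {z | Tendsto (fun n => ‖(hf n).mk (f n) z - hg.mk g z‖) atTop (𝓝 0)} :=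
    measurableSet_tendsto _ fun n =>
      (((hf n).stronglyMeasurable_mk.sub hg.stronglyMeasurable_mk).norm).measurable
  have hae : ∀ᵐ z ∂(μ.prod ν),
      Tendsto (fun n => ‖(hf n).mk (f n) z - hg.mk g z‖) atTop (𝓝 0) := by
    refine (Measure.ae_prod_iff_ae_ae hm).mpr ?_
    filter_upwards [h, Measure.ae_ae_of_ae_prod hall] with x hx hx'
    filter_upwards [hx, hx'] with y hy hy'
    rw [← tendsto_iff_norm_sub_tendsto_zero, ← hy'.2]
    simpa only [← hy'.1] using hy
  filter_upwards [hae, hall] with z hz hz'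
  rw [← tendsto_iff_norm_sub_tendsto_zero, ← hz'.2] at hz
  simpa only [hz'.1] using hz

variable {d : ℕ} {T : ℝ} {g : ℝ → Rd d → Rd d}

theorem volume_restrict_Icc_prod (T : ℝ) (K : Set (Rd d)) :
    (volume : Measure (ℝ × Rd d)).restrict (Icc 0 T ×ˢ K) =
      ((volume : Measure ℝ).restrict (Icc 0 T)).prod ((volume : Measure (Rd d)).restrict K) := by
  rw [Measure.volume_eq_prod, Measure.prod_restrict]

theorem IsLocallyBounded.exists_ae_norm_le (hg : IsLocallyBounded T g) (N : ℝ) :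
    ∃ M : ℝ, ∀ᵐ q ∂((volume : Measure ℝ).restrict (Icc 0 T)),
      ∀ᵐ x ∂((volume : Measure (Rd d)).restrict (Metric.closedBall 0 N)), ‖g q x‖ ≤ M := by
  have h := hg _ (isCompact_closedBall 0 N)
  rw [volume_restrict_Icc_prod] at h
  set μ := ((volume : Measure ℝ).restrict (Icc 0 T)).prod
    ((volume : Measure (Rd d)).restrict (Metric.closedBall 0 N)) with hμ
  set M := (eLpNorm (Function.uncurry g) ∞ μ).toReal with hM
  have hae : ∀ᵐ z ∂μ, ‖g z.1 z.2‖ ≤ M := by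
    filter_upwards [ae_le_eLpNormEssSup (f := Function.uncurry g) (μ := μ)] with z hz
    rw [← eLpNorm_exponent_top] at hz
    have := ENNReal.toReal_mono h.2.ne hz
    rwa [toReal_enorm] at this
  exact ⟨M, Measure.ae_ae_of_ae_prod hae⟩

theorem IsLocallyBounded.ae_locallyIntegrable (hg : IsLocallyBounded T g) :
    ∀ᵐ q ∂((volume : Measure ℝ).restrict (Icc 0 T)), LocallyIntegrable (g q) volume := by
  have h : ∀ n : ℕ, ∀ᵐ q ∂((volume : Measure ℝ).restrict (Icc 0 T)),
      IntegrableOn (g q) (Metric.closedBall 0 n) volume := fun n => by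
    have hK := isCompact_closedBall (0 : Rd d) (n : ℝ)
    have h := hg _ hK
    rw [volume_restrict_Icc_prod] at h
    have : IsFiniteMeasure ((volume : Measure (Rd d)).restrict (Metric.closedBall 0 (n : ℝ))) :=
      ⟨by rw [Measure.restrict_apply_univ]; exact hK.measure_lt_top⟩
    exact (h.integrable le_top).prod_right_ae
  filter_upwards [ae_all_iff.mpr h] with q hq
  rw [locallyIntegrable_iff]
  intro K hK
  obtain ⟨R, hR⟩ := hK.isBounded.subset_closedBall (0 : Rd d)
  obtain ⟨n, hn⟩ := exists_nat_ge R
  exact (hq n).mono_set (hR.trans (Metric.closedBall_subset_closedBall hn))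

theorem IsLocallyBounded.aestronglyMeasurable (hg : IsLocallyBounded T g) :
    AEStronglyMeasurable (Function.uncurry g)
      ((volume : Measure (ℝ × Rd d)).restrict (Icc 0 T ×ˢ univ)) := by
  rw [← Metric.iUnion_closedBall_nat (0 : Rd d), prod_iUnion, aestronglyMeasurable_iUnion_iff]
  exact fun n => (hg _ (isCompact_closedBall 0 (n : ℝ))).1

/-- Makes translated mollifiers admissible tests in `IsGivenBy`. -/
theorem hasCompactSupport_mollifier_compSubConst (b : ContDiffBump (0 : Rd d)) (x : Rd d) :
    HasCompactSupport ((mollifier b).compSubConstCLM ℂ x) := by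
  refine HasCompactSupport.intro (isCompact_closedBall x b.rOut) fun y hy => ?_
  have h : b.normed volume (y - x) = 0 := by
    rw [← Function.notMem_support, b.support_normed_eq, mem_ball_zero_iff, ← dist_eq_norm]
    exact fun h => hy h.le
  rw [SchwartzMap.compSubConstCLM_apply, mollifier_apply, h, Complex.ofReal_zero]

variable {s : ℝ} {r : ℝ≥0∞} [Fact (1 ≤ r)]

/-- If `u` is given by a locally bounded function `g`, then its mollification is the convolution of
`g` with the mollifier. -/
theorem IsGivenBy.ae_regularizeFun_eq {u : C(Icc (0 : ℝ) T, SobolevVec d s r)}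
    (hu : IsGivenBy u g) (hg : IsLocallyBounded T g) :
    ∀ᵐ q ∂((volume : Measure ℝ).restrict (Icc 0 T)), ∀ (b : ContDiffBump (0 : Rd d)) R x,
      regularizeFun b R u q x = cutoff R x •
        convolution (b.normed volume) (g q) (ContinuousLinearMap.lsmul ℝ ℝ) volume x := by
  filter_upwards [ae_restrict_of_ae hu, hg.ae_locallyIntegrable,
    ae_restrict_mem measurableSet_Icc] with q hq hloc hqT b R x
  have hex : ConvolutionExistsAt (b.normed volume) (g q) x (ContinuousLinearMap.lsmul ℝ ℝ) volume :=
    b.hasCompactSupport_normed.convolutionExists_left _ b.continuous_normed hloc x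
  have h_int : Integrable (fun y => b.normed volume (x - y) • g q y) volume :=
    hex.integrable_swap
  ext i
  rw [regularizeFun_apply b R u hqT, PiLp.smul_apply, smul_eq_mul, convolution_eq_swap]
  congr 1
  rw [Sobolev.mollify, hq hqT i _ (hasCompactSupport_mollifier_compSubConst b x)]
  have e1 : (∫ y, b.normed volume (x - y) • g q y) i = ∫ y, b.normed volume (x - y) * g q y i :=
    ((EuclideanSpace.proj (𝕜 := ℝ) i : Rd d →L[ℝ] ℝ).integral_comp_comm h_int).symm
  refine Eq.trans ?_ e1.symm
  rw [← Complex.ofReal_re (∫ y, b.normed volume (x - y) * g q y i), ← integral_complex_ofReal]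
  congr 2; funext y
  -- Evenness of the bump identifies pairing with `ρ(· - x)` and convolution with `ρ`.
  rw [SchwartzMap.compSubConstCLM_apply, mollifier_apply, ← b.normed_neg (y - x), neg_sub,
    Complex.ofReal_mul]

/-- At a point of the `N`-ball the convolution averages `f` over a ball of radius at most `1`,
inside the `(N + 1)`-ball. With all radii at most `1`, one `M` serves every mollifier. -/
theorem norm_convolution_normed_le (b : ContDiffBump (0 : Rd d)) (hb : b.rOut ≤ 1) {f : Rd d → Rd d}
    {M N : ℝ} (hM : ∀ᵐ x ∂((volume : Measure (Rd d)).restrict (Metric.closedBall 0 (N + 1))),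
      ‖f x‖ ≤ M) {x : Rd d} (hx : ‖x‖ ≤ N) :
    ‖convolution (b.normed volume) f (ContinuousLinearMap.lsmul ℝ ℝ) volume x‖ ≤ M := by
  rw [convolution_eq_swap]
  have hi : Integrable (fun y => b.normed volume (x - y)) volume :=
    b.integrable_normed.comp_sub_left x
  calc _ ≤ ∫ y, b.normed volume (x - y) * M := by
        refine norm_integral_le_of_norm_le (hi.mul_const M) ?_
        filter_upwards [(ae_restrict_iff' Metric.isClosed_closedBall.measurableSet).mp hM] with y hy
        rw [ContinuousLinearMap.lsmul_apply, norm_smul, Real.norm_of_nonneg (b.nonneg_normed _)]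
        by_cases h : ‖x - y‖ < b.rOut
        · refine mul_le_mul_of_nonneg_left (hy ?_) (b.nonneg_normed _)
          rw [mem_closedBall_zero_iff]
          have := norm_sub_norm_le y x
          rw [norm_sub_rev] at this
          linarith
        · have : b.normed volume (x - y) = 0 := by
            rw [← Function.notMem_support, b.support_normed_eq]
            simpa using h
          simp [this]
    _ = M := by
        rw [integral_mul_const, integral_sub_left_eq_self (fun y => b.normed volume y),
          b.integral_normed, one_mul]

variable {u : C(Icc (0 : ℝ) T, SobolevVec d s r)} {R : ℕ → ℝ}

theorem IsGivenBy.exists_ae_norm_regularizeFun_le (hu : IsGivenBy u g) (hg : IsLocallyBounded T g)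
    (N : ℝ) : ∃ M : ℝ, ∀ᵐ q ∂((volume : Measure ℝ).restrict (Icc 0 T)), ∀ n x, ‖x‖ ≤ N →
      ‖regularizeFun (bumpSeq d n) (R n) u q x‖ ≤ M := by
  obtain ⟨M, hM⟩ := hg.exists_ae_norm_le (N + 1)
  refine ⟨M, ?_⟩
  filter_upwards [hM, hu.ae_regularizeFun_eq hg] with q hq he n x hx
  rw [he, norm_smul, Real.norm_of_nonneg (cutoff_nonneg _ _)]
  exact (mul_le_of_le_one_left (norm_nonneg _) (cutoff_le_one _ _)).trans
    (norm_convolution_normed_le _ (bumpSeq_rOut_le_one d n) hq hx)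

variable [Fact (r ≠ ∞)]

/-- Lebesgue differentiation on almost every time slice. At a fixed `x` the cutoff is eventually `1`
because `R n → ∞`. -/
theorem IsGivenBy.ae_tendsto_regularizeFun (hu : IsGivenBy u g) (hg : IsLocallyBounded T g)
    (hR : Tendsto R atTop atTop) :
    ∀ᵐ z ∂((volume : Measure (ℝ × Rd d)).restrict (Icc 0 T ×ˢ univ)),
      Tendsto (fun n => regularizeFun (bumpSeq d n) (R n) u z.1 z.2) atTop (𝓝 (g z.1 z.2)) := by
  have hgm := hg.aestronglyMeasurable
  have hlm : ∀ n, AEStronglyMeasurable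
      (Function.uncurry (regularizeFun (bumpSeq d n) (R n) u))
      ((volume : Measure (ℝ × Rd d)).restrict (Icc 0 T ×ˢ univ)) := fun n =>
    (isContinuousCompactSupport_regularizeFun (bumpSeq d n) (R n) u).1.aestronglyMeasurable
      (measurableSet_Icc.prod MeasurableSet.univ)
  rw [volume_restrict_Icc_prod, Measure.restrict_univ] at hgm hlm ⊢
  refine ae_prod_tendsto (f := fun n => Function.uncurry (regularizeFun (bumpSeq d n) (R n) u))
    (g := Function.uncurry g) hlm hgm ?_
  filter_upwards [hg.ae_locallyIntegrable, hu.ae_regularizeFun_eq hg] with q hloc he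
  filter_upwards [ContDiffBump.ae_convolution_tendsto_right_of_locallyIntegrable
    (tendsto_bumpSeq_rOut d) (Eventually.of_forall fun n => bumpSeq_rOut_le d n) hloc] with x hx
  refine hx.congr' ?_
  filter_upwards [hR.eventually_ge_atTop ‖x‖] with n hn
  simp only [Function.uncurry_apply_pair]
  rw [he, cutoff_eq_one hn, one_smul]

end LocallyBounded

/-! ### Passage to the limit along Brownian paths. -/

section Limit

variable {d : ℕ} {T : ℝ} {g : ℝ → Rd d → Rd d} {s : ℝ} {r : ℝ≥0∞} [Fact (1 ≤ r)] [Fact (r ≠ ∞)]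
  {u : C(Icc (0 : ℝ) T, SobolevVec d s r)} {R : ℕ → ℝ}

/-- Along almost every Brownian path, `g` is integrable and its time integrals are the limits of
those of the regularizations. -/
theorem IsBrownianVec.ae_tendsto_integral_regularizeFun {Ω : Type*} [MeasurableSpace Ω]
    {P : Measure Ω} [IsProbabilityMeasure P] {W : ℝ≥0 → Ω → Rd d} (hW : IsBrownianVec W P)
    (hT : 0 ≤ T) (hu : IsGivenBy u g) (hg : IsLocallyBounded T g) (hR : Tendsto R atTop atTop) :
    ∀ᵐ ω ∂P, IntervalIntegrable (fun q => g q (W q.toNNReal ω)) volume 0 T ∧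
      ∀ t ∈ Icc 0 T, Tendsto (fun n => ∫ q in (0 : ℝ)..t,
        regularizeFun (bumpSeq d n) (R n) u q (W q.toNNReal ω)) atTop
        (𝓝 (∫ q in (0 : ℝ)..t, g q (W q.toNNReal ω))) := by
  obtain ⟨V, hV, hVc, hWV⟩ := hW.exists_continuous_modification
  have hbdd : ∀ N : ℕ, ∃ M : ℝ, ∀ᵐ q ∂((volume : Measure ℝ).restrict (Icc 0 T)), ∀ n x, ‖x‖ ≤ N →
      ‖regularizeFun (bumpSeq d n) (R n) u q x‖ ≤ M := fun N =>
    hu.exists_ae_norm_regularizeFun_le hg N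
  have hae := hV.ae_ae_of_ae_volume hVc T (p := fun q x => Tendsto
    (fun n => regularizeFun (bumpSeq d n) (R n) u q x) atTop (𝓝 (g q x)))
    (hu.ae_tendsto_regularizeFun hg hR)
  filter_upwards [hWV, hae] with ω hω hlim
  simp only [hω]
  have hpath : Continuous fun q : ℝ => V q.toNNReal ω := (hVc ω).comp continuous_real_toNNReal
  -- The path is bounded on `[0,T]`; the bound `M` of the regularizations on that ball is the
  -- dominating constant.
  obtain ⟨B, hB⟩ := isCompact_Icc.exists_bound_of_continuousOn (s := Icc 0 T) hpath.continuousOn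
  obtain ⟨N, hN⟩ := exists_nat_ge B
  obtain ⟨M, hM⟩ := hbdd N
  have hmeas : ∀ n, AEStronglyMeasurable
      (fun q => regularizeFun (bumpSeq d n) (R n) u q (V q.toNNReal ω))
      (volume.restrict (Ioc 0 T)) := fun n =>
    ((continuousOn_apply_path (isContinuousCompactSupport_regularizeFun (bumpSeq d n) (R n) u)
      (hVc ω)).mono Ioc_subset_Icc_self).aestronglyMeasurable measurableSet_Ioc
  have hle : ∀ᵐ q ∂((volume : Measure ℝ).restrict (Ioc 0 T)), ∀ n,
      ‖regularizeFun (bumpSeq d n) (R n) u q (V q.toNNReal ω)‖ ≤ M := by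
    filter_upwards [ae_restrict_of_ae_restrict_of_subset Ioc_subset_Icc_self hM,
      ae_restrict_mem measurableSet_Ioc] with q hq hqT n
    exact hq n _ ((hB q ⟨hqT.1.le, hqT.2⟩).trans hN)
  -- Measurability of `g` along the path is inherited from the limit: `g` itself is only almost
  -- everywhere measurable in `(q, x)`.
  have hgmeas : AEStronglyMeasurable (fun q => g q (V q.toNNReal ω))
      (volume.restrict (Ioc 0 T)) := aestronglyMeasurable_of_tendsto_ae atTop hmeas hlim
  have hgle : ∀ᵐ q ∂((volume : Measure ℝ).restrict (Ioc 0 T)), ‖g q (V q.toNNReal ω)‖ ≤ M := by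
    filter_upwards [hle, hlim] with q hq hq'
    exact le_of_tendsto hq'.norm (Eventually.of_forall hq)
  refine ⟨?_, fun t ht => ?_⟩
  · rw [intervalIntegrable_iff_integrableOn_Ioc_of_le hT]
    exact Integrable.of_bound hgmeas M hgle
  · have hsub : Ioc 0 t ⊆ Ioc 0 T := Ioc_subset_Ioc_right ht.2
    simp only [intervalIntegral.integral_of_le ht.1]
    exact tendsto_integral_of_dominated_convergence (fun _ => M)
      (fun n => (hmeas n).mono_measure (Measure.restrict_mono_set _ hsub)) (integrable_const M)
      (fun n => (ae_restrict_of_ae_restrict_of_subset hsub hle).mono fun q hq => hq n)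
      (ae_restrict_of_ae_restrict_of_subset hsub hlim)

end Limit

/-! ### Identification of the extended operator. -/

theorem mainTheorem7 {Ω : Type*} [MeasurableSpace Ω] (P : Measure Ω) [IsProbabilityMeasure P]
    (d : ℕ) (T : ℝ) (hT : 0 < T) (W : ℝ≥0 → Ω → Rd d) (hW : IsBrownianVec W P)
    (s : ℝ) (hs : -(1 / 2) < s) (hs' : s ≤ 0) (r : ℝ≥0∞) [Fact (1 ≤ r)] (hr : 2 ≤ r) (hr' : r < ∞)
    (A : C(Icc (0 : ℝ) T, SobolevVec d s r) → ContinuousProcess Ω T (Rd d))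
    (hA : IsIntegralOperator P W W A)
    (g : ℝ → Rd d → Rd d) (hg : IsLocallyBounded T g)
    (u : C(Icc (0 : ℝ) T, SobolevVec d s r)) (hu : IsGivenBy u g) :
    ∀ᵐ ω ∂P, IntervalIntegrable (fun q => g q (W q.toNNReal ω)) volume 0 T ∧
      ∀ t ∈ Icc 0 T, (A u).val t ω = ∫ q in (0 : ℝ)..t, g q (W q.toNNReal ω) := by
  have : Fact (r ≠ ∞) := ⟨hr'.ne⟩
  obtain ⟨R, hR, hlim⟩ := exists_tendsto_regularizeMap hs' u
  obtain ⟨C, hC, hext⟩ := hA.extension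
  have hpaths := hW.ae_tendsto_integral_regularizeFun hT.le hu hg hR
  have hreg : ∀ᵐ ω ∂P, ∀ n, ∀ t ∈ Icc 0 T,
      (A (regularizeMap hs' (bumpSeq d n) (R n) u)).val t ω =
        ∫ q in (0 : ℝ)..t, regularizeFun (bumpSeq d n) (R n) u q (W q.toNNReal ω) :=
    ae_all_iff.mpr fun n => by
      have hl := isContinuousCompactSupport_regularizeFun (bumpSeq d n) (R n) u
      exact hW.integralAgainst_eq hC hl
        (hext _ hl _ (isGivenBy_regularizeMap hs' (bumpSeq d n) (R n) u))
  have hucp : TendstoUCP P T (fun n => (A (regularizeMap hs' (bumpSeq d n) (R n) u)).val) atTop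
      (A u).val := fun η hη => (hA.continuity u η hη).comp hlim
  have heq : ∀ᵐ ω ∂P, ∀ t ∈ Icc 0 T, (A u).val t ω =
      ∫ q in (0 : ℝ)..t, g q (W q.toNNReal ω) := by
    refine ae_forall_mem_Icc_eq (ae_of_all _ (A u).continuousOn) ?_ fun t ht => ?_
    · filter_upwards [hpaths] with ω hω
      have := intervalIntegral.continuousOn_primitive_interval'
        (hω.1) (left_mem_uIcc)
      rwa [uIcc_of_le hT.le] at this
    -- At a fixed time a subsequence of `A(l_n)` converges almost surely to `A(u)`, while the same
    -- time integrals converge to that of `g` along the whole sequence.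
    · obtain ⟨ns, hns, hae⟩ := (hucp.tendstoInMeasure ht).exists_seq_tendsto_ae
      filter_upwards [hae, hpaths, hreg] with ω h1 h2 h3
      refine tendsto_nhds_unique h1 (((h2.2 t ht).comp hns.tendsto_atTop).congr fun k => ?_)
      exact (h3 (ns k) t ht).symm
  filter_upwards [hpaths, heq] with ω h1 h2
  exact ⟨h1.1, h2⟩
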